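/- Let $p_k,q_k$ $(k\ge 0)$ be real numbers with $p_0=1$, $q_0=0$, and $p_k>0$, $q_k>0$, $p_k+q_k=1$ for all $k\ge1$. Let $X=(X_k)_{k\ge0}$ be the Markov chain on $\mathbb Z_+=\{0,1,2,\dots\}$ with $X_0=0$ that jumps from $n$ to $n+1$ with probability $p_n$ and from $n$ to $n-1$ with probability $q_n$. Put $\rho_k=q_k/p_k$ and, for $m\ge0$, $$D(m)=\lim_{n\to\infty}\Big(1+\sum_{j=1}^{n-m-1}\rho_{m+1}\cdots\rho_{m+j}\Big)\in[1,\infty],\qquad \tfrac1\infty:=0 .$$ For $x\in\mathbb Z_+$ let $\xi(x)=\#\{k\ge0: X_k=x\}$ be the local time at $x$ and $\xi(x,\uparrow)=\#\{k\ge0: X_k=x,\ X_{k+1}=x+1\}$ the upcrossing time from $x$ to $x+1$. For $A,B\subseteq\{1,2,\dots\}$ let $C(A,B)=\{x\in\mathbb Z_+:\xi(x)\in A,\ \xi(x,\uparrow)\in B\}$, and write $C(A,a)=C(A,\{a\})$, $C(a,B)=C(\{a\},B)$. Call $x\in\mathbb Z_+$ a weak cutpoint if for some $k$ one has $X_k=x$,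 $X_i\le x$ for all $i<k$, and $X_i\ge x$ for all $i>k$; let $C_w$ be the set of weak cutpoints. Theorem. Suppose that $\rho_k$ is (weakly) increasing in $k>N_0$ for some $N_0>0$ and that $\rho_k\to1$ as $k\to\infty$. If $\sum_{n=2}^\infty\frac{1}{D(n)\log n}<\infty$, then almost surely: (i) $|C(A,a)|<\infty$ for each $a\in\{1,2,\dots\}$ and each $A\subseteq\{a,a+1,\dots\}$; (ii) $|C(a,B)|<\infty$ for each $a\in\{1,2,\dots\}$ and each $B\subseteq\{1,\dots,a\}$; (iii) $|C_w|<\infty$. If there are $n_0>0$ and $\delta>0$ with $D(n)\le\delta n\log n$ for all $n\ge n_0$, and $\sum_{n=2}^\infty\frac{1}{D(n)\log n}=\infty$, then almost surely: (i) $|C(A,a)|=\infty$ for each $a\in\{1,2,\dots\}$ and each nonempty $A\subseteq\{a,a+1,\dots\}$; (ii) $|C(a,B)|=\infty$ for each $a\in\{1,2,\dots\}$ and each nonempty $B\subseteq\{1,\dots,a\}$; (iii) $|C_w|=\infty$. -/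

import Mathlib

open MeasureTheory Filter Topology
open scoped ENNReal

namespace BirthDeath

noncomputable section

/-- One-step transition probability from `x` to `y`: up with probability `p x`, down with
probability `q x`. -/
def trans (p q : ℕ → ℝ) (x y : ℕ) : ℝ :=
  if y = x + 1 then p x else if x = y + 1 then q x else 0

/-- `X` is a Markov chain on `ℕ` started from `0` with transition probabilities `trans p q`.
The Markov property is stated in product form, so that no conditioning on null events occurs. -/
structure IsWalk {Ω : Type*} [MeasurableSpace Ω] (μ : Measure Ω) (p q : ℕ → ℝ)
    (X : ℕ → Ω → ℕ) : Prop where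
  measurable : ∀ k, Measurable (X k)
  start : ∀ᵐ ω ∂μ, X 0 ω = 0
  markov : ∀ (k : ℕ) (s : ℕ → ℕ) (y : ℕ),
    μ {ω | (∀ i ≤ k, X i ω = s i) ∧ X (k + 1) ω = y} =
      μ {ω | ∀ i ≤ k, X i ω = s i} * ENNReal.ofReal (trans p q (s k) y)

/-- `ρ k = q k / p k`. -/
def rho (p q : ℕ → ℝ) (k : ℕ) : ℝ := q k / p k

/-- `D(m, n) = 1 + ∑_{j=1}^{n-m-1} ρ_{m+1} ⋯ ρ_{m+j}` for `n > m`, and `D(m, m) = 0`. The summand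
`j = 0` below is the empty product `1`. -/
def Dfin (p q : ℕ → ℝ) (m n : ℕ) : ℝ :=
  ∑ j ∈ Finset.range (n - m), ∏ i ∈ Finset.range j, rho p q (m + 1 + i)

/-- `D(m) = lim_n D(m, n) ∈ [0, ∞]`, the limit of a nondecreasing sequence
(see `tendsto_Dfin`). -/
def D (p q : ℕ → ℝ) (m : ℕ) : ℝ≥0∞ := ⨆ n, ENNReal.ofReal (Dfin p q m n)

theorem tendsto_Dfin (p q : ℕ → ℝ) (hp : ∀ k, 0 ≤ p k) (hq : ∀ k, 0 ≤ q k) (m : ℕ) :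
    Tendsto (fun n => ENNReal.ofReal (Dfin p q m n)) atTop (𝓝 (D p q m)) := by
  refine tendsto_atTop_iSup fun a b hab => ENNReal.ofReal_le_ofReal ?_
  refine Finset.sum_le_sum_of_subset_of_nonneg (Finset.range_mono (by omega)) fun j _ _ => ?_
  exact Finset.prod_nonneg fun i _ => div_nonneg (hq _) (hp _)

/-- `∑_{n ≥ 2} 1 / (D(n) log n)`, where `1 / ∞ = 0`. -/
def criterionSum (p q : ℕ → ℝ) : ℝ≥0∞ :=
  ∑' n : ℕ, (D p q (n + 2) * ENNReal.ofReal (Real.log ((n + 2 : ℕ) : ℝ)))⁻¹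

/-- Local time `ξ(x)` of a path at `x`, possibly infinite. -/
def localTime (w : ℕ → ℕ) (x : ℕ) : ℕ∞ := {k : ℕ | w k = x}.encard

/-- Upcrossing time `ξ(x, ↑)` of a path from `x` to `x + 1`, possibly infinite. -/
def upTime (w : ℕ → ℕ) (x : ℕ) : ℕ∞ := {k : ℕ | w k = x ∧ w (k + 1) = x + 1}.encard

/-- `C(A, B)`: the sites whose local time lies in `A` and whose upcrossing time lies in `B`;
in particular both are finite. -/
def C (w : ℕ → ℕ) (A B : Set ℕ) : Set ℕ :=
  {x | (∃ m ∈ A, localTime w x = (m : ℕ∞)) ∧ (∃ l ∈ B, upTime w x = (l : ℕ∞))}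

/-- `x` is a weak cutpoint of the path: for some `k`, the path is at `x` at time `k`, is `≤ x`
before and `≥ x` afterwards. -/
def IsWeakCutpoint (w : ℕ → ℕ) (x : ℕ) : Prop :=
  ∃ k, w k = x ∧ (∀ i < k, w i ≤ x) ∧ (∀ i > k, x ≤ w i)

/-- `C_w`, the set of weak cutpoints. -/
def Cw (w : ℕ → ℕ) : Set ℕ := {x | IsWeakCutpoint w x}

end

end BirthDeath

namespace BirthDeath

noncomputable section

/-! ### Paths driven by stacks of instructions -/

/-! The walk is read off from independent stacks of instructions, one stack per site (`walk`,
`Admissible.isWalk`). The law of a walk is determined by its transition probabilities, so almost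
sure statements need only be checked for this one (`IsWalk.ae_of_driven`).

Let `ret σ x n` be the number of downcrossings from `x + 1` to `x` before `x + 1 + n` is reached. As
`x` decreases this is a branching process with geometric offspring and one immigrant: `v`
downcrossings from `x + 2` to `x + 1` mean `v + 1` upcrossings from `x + 1`, and the downward steps
from `x + 1` are those preceding upward step number `v + 1`. Composing linear fractional generating
functions gives `E s ^ ret = 1 / (s + (1 - s) * D(x, x + 1 + n))` (`Admissible.tsum_ret`), so the
edge below `x + 1` is never crossed downwards with probability `1 / D(x)`. If `ret σ x` is
eventually `v`, the upcrossing time at `x` is `v + 1` and the local time is `fails σ x v + v + 1`.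

Convergent case. Far out `ρ ≤ 1`, hence `D(x, y) ≤ y - x`. Let `y` be the last special site below
`M`. Given this, each `x < y` is never returned to from `x + 1` with probability at least `c / (y -
x)`, so the expected number of such `x` near `y` is at least a multiple of `log y`. Without
conditioning it is `∑ 1 / D(x)`. Hence a dyadic block contains a special site with probability at
most a multiple of `∑ 1 / (D(x) log x)` over nearby `x`, and Borel-Cantelli applies
(`Splitting.measure_biUnion_le`, `Splitting.ae_finite`).

Divergent case. `cutEvent i j z` fixes the first instructions at three consecutive sites so that `z
- 1` has upcrossing time `i + 1` and local time `i + j + 1`, with no return at either end. For `x <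
z - 2` the joint probability is at most that of the event at `z` times a constant over `D(x, z -
2)`. Weighting the events by `1 / log z` makes the expected count diverge, and `sum_div_sub_le`
shows that replacing `D(x, y)` by `D(x)` costs only a bounded term and a factor arbitrarily close to
`1`. The second moment method then gives infinitely many events almost surely, with no zero-one law.
-/

/-- Bit `(x, i)` tells in which direction the `i`-th departure from `x` goes. -/
abbrev Stacks : Type := ℕ × ℕ → Bool

/-- Number of visits of `w` to `x` before time `k`. -/
abbrev visits (w : ℕ → ℕ) (k x : ℕ) : ℕ := Nat.count (fun i => w i = x) k

/-- Number of upward instructions among the first `n` in stack `x`. -/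
abbrev ups (σ : Stacks) (x n : ℕ) : ℕ := Nat.count (fun i => σ (x, i) = true) n

/-- The path `w` follows the instructions in `σ`. -/
structure Driven (σ : Stacks) (w : ℕ → ℕ) : Prop where
  start : w 0 = 0
  step : ∀ k, w (k + 1) = if σ (w k, visits w k (w k)) = true then w k + 1 else w k - 1

/-- Stacks for which the driven path is well behaved. -/
structure Good (σ : Stacks) : Prop where
  up_io : ∀ x, {i | σ (x, i) = true}.Infinite
  down_io : ∀ x, 1 ≤ x → {i | σ (x, i) = false}.Infinite
  zero : ∀ i, σ (0, i) = true

/-- Number of downward instructions in stack `x` before the upward one with index `v`. -/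
def fails (σ : Stacks) (x v : ℕ) : ℕ := Nat.nth (fun i => σ (x, i) = true) v - v

/-- Number of downcrossings from `x + 1` to `x` before the first visit to `x + 1 + n`. -/
def ret (σ : Stacks) : ℕ → ℕ → ℕ
  | _, 0 => 0
  | x, n + 1 => fails σ (x + 1) (ret σ (x + 1) n)

@[simp] theorem ret_zero (σ : Stacks) (x : ℕ) : ret σ x 0 = 0 := rfl

theorem ret_succ (σ : Stacks) (x n : ℕ) :
    ret σ x (n + 1) = fails σ (x + 1) (ret σ (x + 1) n) := rfl

/-! ### Deterministic crossing counts of a driven path. -/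

section Driven

variable {σ : Stacks} {w : ℕ → ℕ}

theorem Driven.step_cases (h : Driven σ w) (hσ : Good σ) (k : ℕ) :
    (σ (w k, visits w k (w k)) = true ∧ w (k + 1) = w k + 1) ∨
      (σ (w k, visits w k (w k)) = false ∧ w (k + 1) + 1 = w k) := by
  have hs := h.step k
  by_cases hb : σ (w k, visits w k (w k)) = true
  · left; rw [if_pos hb] at hs; exact ⟨hb, hs⟩
  · right
    rw [if_neg hb] at hs
    refine ⟨by simpa using hb, ?_⟩
    have : w k ≠ 0 := by
      intro h0
      rw [h0] at hb
      exact hb (hσ.zero _)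
    omega

theorem visits_succ (w : ℕ → ℕ) (k x : ℕ) :
    visits w (k + 1) x = visits w k x + if w k = x then 1 else 0 := by
  simp [visits, Nat.count_succ]

theorem Driven.count_up (h : Driven σ w) (hσ : Good σ) (x k : ℕ) :
    Nat.count (fun i => w i = x ∧ w (i + 1) = x + 1) k = ups σ x (visits w k x) := by
  induction k with
  | zero => simp [visits, ups]
  | succ k ih =>
    rw [Nat.count_succ, ih, visits_succ]
    by_cases hx : w k = x
    · subst hx
      rcases h.step_cases hσ k with ⟨h1, h2⟩ | ⟨h1, h2⟩
      · simp [h2, ups, Nat.count_succ, h1]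
      · have : w (k + 1) ≠ w k + 1 := by omega
        simp [this, ups, Nat.count_succ, h1]
    · simp [hx]

/-- Crossings of the edge between `x` and `x + 1` alternate, beginning with an upward one. The
downward ones are the visits to `x + 1` not followed by an upward step, moved across the equation to
avoid subtraction. -/
theorem Driven.flow (h : Driven σ w) (hσ : Good σ) (x k : ℕ) :
    ups σ x (visits w k x) + ups σ (x + 1) (visits w k (x + 1)) =
      visits w k (x + 1) + if x < w k then 1 else 0 := by
  induction k with
  | zero => simp [visits, ups, h.start]
  | succ k ih =>
    rw [visits_succ, visits_succ]
    rcases h.step_cases hσ k with ⟨h1, h2⟩ | ⟨h1, h2⟩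
    · rw [h2]
      by_cases hx : w k = x
      · subst hx
        simp [ups, Nat.count_succ, h1] at ih ⊢
        omega
      · by_cases hx' : w k = x + 1
        · rw [hx'] at h1
          simp [hx', ups, Nat.count_succ, h1] at ih ⊢
          omega
        · simp only [hx, hx', if_false, add_zero]
          rw [ih]
          congr 1
          have : x < w k ↔ x < w k + 1 := by omega
          simp [this]
    · by_cases hx : w k = x
      · subst hx
        have : ¬ w k < w (k + 1) := by omega
        simp [ups, Nat.count_succ, h1, this] at ih ⊢
        omega
      · by_cases hx' : w k = x + 1
        · have : ¬ x < w (k + 1) := by omega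
          rw [hx'] at h1
          simp [hx', ups, Nat.count_succ, h1, this] at ih ⊢
          omega
        · simp only [hx, hx', if_false, add_zero]
          rw [ih]
          congr 1
          have : x < w k ↔ x < w (k + 1) := by omega
          simp [this]

/-- A path above `x` left `x` upwards at its last departure. So the number of instructions used at
`x` can be recovered from the number of upward ones among them. -/
theorem Driven.last_up (h : Driven σ w) (hσ : Good σ) (x k : ℕ) (hx : x < w k) :
    ∃ n, visits w k x = n + 1 ∧ σ (x, n) = true := by
  induction k with
  | zero => rw [h.start] at hx; omega
  | succ k ih =>
    rw [visits_succ]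
    rcases h.step_cases hσ k with ⟨h1, h2⟩ | ⟨h1, h2⟩
    · by_cases hx' : w k = x
      · subst hx'
        exact ⟨_, by simp, h1⟩
      · obtain ⟨n, hn, hn'⟩ := ih (by omega)
        exact ⟨n, by simp [hx', hn], hn'⟩
    · obtain ⟨n, hn, hn'⟩ := ih (by omega)
      exact ⟨n, by have : w k ≠ x := by omega
                   simp [this, hn], hn'⟩

theorem Driven.le_self (h : Driven σ w) (hσ : Good σ) (k : ℕ) : w k ≤ k := by
  induction k with
  | zero => rw [h.start]
  | succ k ih => rcases h.step_cases hσ k with ⟨h1, h2⟩ | ⟨h1, h2⟩ <;> omega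

theorem sum_visits (w : ℕ → ℕ) (N k : ℕ) (h : ∀ i < k, w i < N) :
    ∑ x ∈ Finset.range N, visits w k x = k := by
  induction k with
  | zero => simp [visits]
  | succ k ih =>
    simp only [visits_succ, Finset.sum_add_distrib]
    rw [ih fun i hi => h i (by omega)]
    simp [h k (by omega)]

theorem ups_unbounded (hσ : Good σ) (x B : ℕ) : ∃ n, ∀ m, ups σ x m ≤ B → m ≤ n := by
  refine ⟨Nat.nth (fun i => σ (x, i) = true) B, fun m hm => ?_⟩
  by_contra! hlt
  have h1 : ups σ x (Nat.nth (fun i => σ (x, i) = true) B + 1) = B + 1 := by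
    unfold ups
    rw [Nat.count_nth_succ_of_infinite (hσ.up_io x)]
  have h2 := Nat.count_monotone (fun i => σ (x, i) = true)
    (show Nat.nth (fun i => σ (x, i) = true) B + 1 ≤ m from hlt)
  simp only [ups] at h1 hm
  omega

/-- On a path confined below `N`, bounded visits to `x + 1` bound the upcrossings from `x` by
`Driven.flow`, hence the visits to `x`, as upward instructions never run out. Descending from `N`,
all visit counts are bounded, yet they add up to the elapsed time. -/
theorem Driven.exists_hit (h : Driven σ w) (hσ : Good σ) (N : ℕ) : ∃ k, w k = N := by
  by_contra! hN
  have hlt : ∀ k, w k < N := by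
    intro k
    induction k with
    | zero => rw [h.start]; have := hN 0; rw [h.start] at this; omega
    | succ k ih =>
      have := hN (k + 1)
      rcases h.step_cases hσ k with ⟨h1, h2⟩ | ⟨h1, h2⟩ <;> omega
  have hb : ∀ d, d ≤ N → ∃ B, ∀ k, visits w k (N - d) ≤ B := by
    intro d
    induction d with
    | zero =>
      intro _
      refine ⟨0, fun k => ?_⟩
      have : visits w k N = 0 := by
        induction k with
        | zero => simp [visits]
        | succ k ih => rw [visits_succ, ih]; simp [hN k]
      simp [this]
    | succ d ih =>
      intro hd
      obtain ⟨B, hB⟩ := ih (by omega)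
      obtain ⟨n, hn⟩ := ups_unbounded hσ (N - (d + 1)) (B + 1)
      refine ⟨n, fun k => hn _ ?_⟩
      have hf := h.flow hσ (N - (d + 1)) k
      rw [show N - (d + 1) + 1 = N - d by omega] at hf
      have := hB k
      split_ifs at hf <;> omega
  have hb' : ∀ x, ∃ B, x ≤ N → ∀ k, visits w k x ≤ B := by
    intro x
    by_cases hx : x ≤ N
    · obtain ⟨B, hB⟩ := hb (N - x) (by omega)
      rw [show N - (N - x) = x by omega] at hB
      exact ⟨B, fun _ => hB⟩
    · exact ⟨0, fun h => absurd h hx⟩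
  choose B hB using hb'
  have h1 := sum_visits w N (∑ x ∈ Finset.range N, B x + 1) fun i _ => hlt i
  have h2 : ∑ x ∈ Finset.range N, visits w (∑ x ∈ Finset.range N, B x + 1) x ≤
      ∑ x ∈ Finset.range N, B x :=
    Finset.sum_le_sum fun x hx => hB x (by simp at hx; omega) _
  omega

/-- First time at which `w` visits `N`. -/
def hit (w : ℕ → ℕ) (N : ℕ) : ℕ := sInf {k | w k = N}

theorem Driven.apply_hit (h : Driven σ w) (hσ : Good σ) (N : ℕ) : w (hit w N) = N :=
  Nat.sInf_mem (s := {k | w k = N}) (h.exists_hit hσ N)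

theorem visits_hit (w : ℕ → ℕ) (N : ℕ) : visits w (hit w N) N = 0 := by
  unfold visits
  rw [Nat.count_eq_card_filter_range, Finset.card_eq_zero, Finset.filter_eq_empty_iff]
  intro i hi h
  have := Nat.sInf_le (s := {k | w k = N}) h
  simp only [Finset.mem_range] at hi
  unfold hit at hi
  omega

theorem Driven.le_hit (h : Driven σ w) (hσ : Good σ) (N : ℕ) : N ≤ hit w N := by
  have := h.le_self hσ (hit w N)
  rwa [h.apply_hit hσ] at this

/-- At the hitting time the path is above `x`, so upcrossings from `x` exceed downcrossings from `x
+ 1` by one. The latter are the downward instructions preceding the last upward one used at `x + 1`,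
which is the recursion defining `ret`. -/
theorem Driven.visits_eq (h : Driven σ w) (hσ : Good σ) (n x : ℕ) :
    ups σ x (visits w (hit w (x + 1 + n)) x) = ret σ x n + 1 ∧
      visits w (hit w (x + 1 + n)) x = fails σ x (ret σ x n) + ret σ x n + 1 := by
  have key : ∀ v, ∀ N, x < N → ups σ x (visits w (hit w N) x) = v + 1 →
      visits w (hit w N) x = fails σ x v + v + 1 := by
    intro v N hN hv
    obtain ⟨m, hm, hm'⟩ := h.last_up hσ x (hit w N) (by rw [h.apply_hit hσ]; exact hN)
    rw [hm] at hv ⊢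
    have hv' : Nat.count (fun i => σ (x, i) = true) m = v := by
      simpa [ups, Nat.count_succ, hm'] using hv
    have : Nat.nth (fun i => σ (x, i) = true) v = m := by
      rw [← hv']; exact Nat.nth_count (p := fun i => σ (x, i) = true) hm'
    have hle : v ≤ m := by rw [← hv']; exact Nat.count_le _
    unfold fails
    rw [this]; omega
  suffices hs : ups σ x (visits w (hit w (x + 1 + n)) x) = ret σ x n + 1 from
    ⟨hs, key _ _ (by omega) hs⟩
  clear key
  induction n generalizing x with
  | zero =>
    have hf := h.flow hσ x (hit w (x + 1))
    rw [visits_hit, h.apply_hit hσ] at hf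
    simpa [ups] using hf
  | succ n ih =>
    have hf := h.flow hσ x (hit w (x + 1 + (n + 1)))
    have e : x + 1 + (n + 1) = x + 1 + 1 + n := by omega
    have ih1 := ih (x + 1)
    rw [h.apply_hit hσ, if_pos (by omega), e, ih1] at hf
    obtain ⟨m, hm, hm'⟩ := h.last_up hσ (x + 1) (hit w (x + 1 + 1 + n))
      (by rw [h.apply_hit hσ]; omega)
    rw [hm] at ih1
    have hv' : Nat.count (fun i => σ (x + 1, i) = true) m = ret σ (x + 1) n := by
      simpa [ups, Nat.count_succ, hm'] using ih1
    have h3 : Nat.nth (fun i => σ (x + 1, i) = true) (ret σ (x + 1) n) = m := by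
      rw [← hv']; exact Nat.nth_count (p := fun i => σ (x + 1, i) = true) hm'
    rw [e, ret_succ, fails, h3]
    have hle : ret σ (x + 1) n ≤ m := by rw [← hv']; exact Nat.count_le _
    omega

/-! ### Total crossing and visit counts as eventual values. -/

theorem encard_eq_of_eventually_count {P : ℕ → Prop} [DecidablePred P] {a : ℕ}
    (h : ∀ᶠ k in atTop, Nat.count P k = a) : {k | P k}.encard = a := by
  obtain ⟨K, hK⟩ := eventually_atTop.1 h
  have hs : {k | P k} = ↑((Finset.range K).filter P) := by
    ext k
    simp only [Set.mem_ofPred_eq, Finset.coe_filter, Finset.mem_range]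
    refine ⟨fun hk => ⟨?_, hk⟩, fun hk => hk.2⟩
    by_contra! hlt
    have h1 := hK k hlt
    have h2 := hK (k + 1) (by omega)
    rw [Nat.count_succ, if_pos hk] at h2
    omega
  rw [hs, Set.encard_coe_eq_coe_finsetCard, ← Nat.count_eq_card_filter_range, hK K le_rfl]

theorem eventually_count_of_encard_eq {P : ℕ → Prop} [DecidablePred P] {a : ℕ}
    (h : {k | P k}.encard = a) : ∀ᶠ k in atTop, Nat.count P k = a := by
  have hf : {k | P k}.Finite := Set.finite_of_encard_eq_coe h
  obtain ⟨K, hK⟩ := hf.bddAbove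
  filter_upwards [eventually_gt_atTop K] with k hk
  have hs : {k | P k} = ↑((Finset.range k).filter P) := by
    ext i
    simp only [Set.mem_ofPred_eq, Finset.coe_filter, Finset.mem_range]
    exact ⟨fun hi => ⟨lt_of_le_of_lt (hK hi) hk, hi⟩, fun hi => hi.2⟩
  rw [hs, Set.encard_coe_eq_coe_finsetCard, ← Nat.count_eq_card_filter_range] at h
  exact_mod_cast h

/-- If the count equals `a` at infinitely many prescribed times then it is eventually `a`. -/
theorem eventually_count_of_subseq {P : ℕ → Prop} [DecidablePred P] {a : ℕ} {τ : ℕ → ℕ}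
    (hτ : Tendsto τ atTop atTop) (h : ∀ᶠ n in atTop, Nat.count P (τ n) = a) :
    ∀ᶠ k in atTop, Nat.count P k = a := by
  obtain ⟨n, hn⟩ := h.exists
  filter_upwards [eventually_ge_atTop (τ n)] with k hk
  obtain ⟨m, hm, hm'⟩ := (h.and (hτ.eventually_ge_atTop k)).exists
  have h1 := Nat.count_monotone P hk
  have h2 := Nat.count_monotone P hm'
  omega

theorem Driven.tendsto_hit (h : Driven σ w) (hσ : Good σ) (x : ℕ) :
    Tendsto (fun n => hit w (x + 1 + n)) atTop atTop :=
  tendsto_atTop_mono (fun n => le_trans (show n ≤ x + 1 + n by omega) (h.le_hit hσ (x + 1 + n)))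
    tendsto_id

theorem Driven.eventually_ret (h : Driven σ w) (hσ : Good σ) {x v : ℕ}
    (hv : upTime w x = ((v + 1 : ℕ) : ℕ∞)) : ∀ᶠ n in atTop, ret σ x n = v := by
  have := (h.tendsto_hit hσ x).eventually (eventually_count_of_encard_eq hv)
  filter_upwards [this] with n hn
  rw [h.count_up hσ, (h.visits_eq hσ n x).1] at hn
  omega

theorem Driven.upTime_eq (h : Driven σ w) (hσ : Good σ) {x v : ℕ}
    (hv : ∀ᶠ n in atTop, ret σ x n = v) : upTime w x = ((v + 1 : ℕ) : ℕ∞) := by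
  refine encard_eq_of_eventually_count (eventually_count_of_subseq (h.tendsto_hit hσ x) ?_)
  filter_upwards [hv] with n hn
  rw [h.count_up hσ, (h.visits_eq hσ n x).1, hn]

theorem Driven.localTime_eq (h : Driven σ w) (hσ : Good σ) {x v : ℕ}
    (hv : ∀ᶠ n in atTop, ret σ x n = v) :
    localTime w x = ((fails σ x v + v + 1 : ℕ) : ℕ∞) := by
  refine encard_eq_of_eventually_count (eventually_count_of_subseq (h.tendsto_hit hσ x) ?_)
  filter_upwards [hv] with n hn
  have := (h.visits_eq hσ n x).2
  rw [hn] at this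
  exact this

theorem fails_mono (hσ : Good σ) (x : ℕ) : Monotone (fails σ x) := by
  refine monotone_nat_of_le_succ fun v => ?_
  have := Nat.nth_strictMono (hσ.up_io x) (show v < v + 1 by omega)
  unfold fails
  omega

theorem ret_mono (hσ : Good σ) (x : ℕ) : Monotone (ret σ x) := by
  refine monotone_nat_of_le_succ fun n => ?_
  induction n generalizing x with
  | zero => simp
  | succ n ih => rw [ret_succ, ret_succ]; exact fails_mono hσ _ (ih _)

theorem eventually_ret_zero_iff (hσ : Good σ) (x : ℕ) :
    (∀ᶠ n in atTop, ret σ x n = 0) ↔ ∀ n, ret σ x n = 0 := by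
  refine ⟨fun h n => ?_, fun h => Eventually.of_forall h⟩
  obtain ⟨m, hm, hm'⟩ := (h.and (eventually_ge_atTop n)).exists
  have := ret_mono hσ x hm'
  omega

theorem eventually_ret_step {x v : ℕ} (h : ∀ᶠ n in atTop, ret σ (x + 1) n = v) :
    ∀ᶠ n in atTop, ret σ x n = fails σ (x + 1) v := by
  obtain ⟨N, hN⟩ := eventually_atTop.1 h
  refine eventually_atTop.2 ⟨N + 1, fun n hn => ?_⟩
  obtain ⟨m, rfl⟩ := Nat.exists_eq_add_of_le' hn
  rw [show m + (N + 1) = m + N + 1 by omega, ret_succ, hN _ (by omega)]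

/-- If the path does not fall back below `x + d + 1` once it gets there, the count at `x` is
complete at that moment. This decouples the stacks on the two sides. -/
theorem ret_add (σ : Stacks) (x d n : ℕ) (h : ret σ (x + d) n = 0) :
    ret σ x (d + n) = ret σ x d := by
  induction d generalizing x with
  | zero => simpa using h
  | succ d ih =>
    rw [show d + 1 + n = d + n + 1 by omega, ret_succ, ret_succ, ih]
    rwa [show x + 1 + d = x + (d + 1) by omega]

/-! ### Initial patterns of a stack and weak cutpoints. -/

/-- Stack `x` starts with `j` downward instructions followed by `u` upward ones. -/
def Pattern (σ : Stacks) (x j u : ℕ) : Prop :=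
  (∀ i < j, σ (x, i) = false) ∧ ∀ i, j ≤ i → i < j + u → σ (x, i) = true

theorem Pattern.count {x j u : ℕ} (h : Pattern σ x j u) (i : ℕ) (hi : i ≤ u) :
    ups σ x (j + i) = i := by
  induction i with
  | zero =>
    rw [add_zero, ups, Nat.count_eq_card_filter_range, Finset.card_eq_zero,
      Finset.filter_eq_empty_iff]
    intro i hi
    simp [h.1 i (by simpa using hi)]
  | succ i ih =>
    have := ih (by omega)
    simp only [ups] at this ⊢
    rw [← add_assoc, Nat.count_succ, this, if_pos (h.2 _ (by omega) (by omega))]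

theorem Pattern.fails_eq {x j v : ℕ} (h : Pattern σ x j (v + 1)) : fails σ x v = j := by
  have h1 := h.count v (by omega)
  have h2 : Nat.nth (fun i => σ (x, i) = true) v = j + v := by
    conv_lhs => rw [← h1]
    exact Nat.nth_count (p := fun i => σ (x, i) = true) (h.2 _ (by omega) (by omega))
  unfold fails
  omega

/-- A weak cutpoint forces its stack to start with downs only followed by ups only. -/
theorem Driven.pattern_of_weak (h : Driven σ w) (hσ : Good σ) {y : ℕ} (hy : 1 ≤ y)
    (hw : IsWeakCutpoint w y) :
    ∃ v j, (∀ᶠ n in atTop, ret σ y n = v) ∧ Pattern σ y j (v + 1) := by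
  obtain ⟨k, hk, hbefore, hafter⟩ := hw
  -- departures before time `k` go down, the later ones go up
  have hdown : ∀ i < visits w k y, σ (y, i) = false := by
    have : ∀ m ≤ k, ∀ i < visits w m y, σ (y, i) = false := by
      intro m
      induction m with
      | zero => intro _ i hi; simp [visits] at hi
      | succ m ih =>
        intro hm i hi
        rw [visits_succ] at hi
        by_cases hmy : w m = y
        · rw [if_pos hmy] at hi
          rcases Nat.lt_succ_iff_lt_or_eq.1 hi with hi | hi
          · exact ih (by omega) i hi
          · rcases h.step_cases hσ m with ⟨h1, h2⟩ | ⟨h1, h2⟩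
            · rcases Nat.lt_or_ge (m + 1) k with hlt | hge
              · have := hbefore _ hlt; omega
              · have : m + 1 = k := by omega
                rw [this] at h2; omega
            · rw [hmy] at h1; rw [hi]; exact h1
        · rw [if_neg hmy] at hi
          exact ih (by omega) i hi
    exact this k le_rfl
  have hup : ∀ m, k ≤ m → ∀ i, visits w k y ≤ i → i < visits w m y → σ (y, i) = true := by
    intro m hm
    induction m, hm using Nat.le_induction with
    | base => intro i h1 h2; omega
    | succ m hm ih =>
      intro i h1 h2
      rw [visits_succ] at h2
      by_cases hmy : w m = y
      · rw [if_pos hmy] at h2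
        rcases Nat.lt_succ_iff_lt_or_eq.1 h2 with h2 | h2
        · exact ih i h1 h2
        · rcases h.step_cases hσ m with ⟨h3, h4⟩ | ⟨h3, h4⟩
          · rw [hmy] at h3; rw [h2]; exact h3
          · have := hafter (m + 1) (by omega); omega
      · rw [if_neg hmy] at h2
        exact ih i h1 h2
  -- A downward instruction beyond those consumed by time `k` can never be used, so `J` bounds the
  -- visits to `y` and the monotone sequence `ret σ y` stabilises. Site `0` is excluded because it
  -- has no downward instructions.
  obtain ⟨J, hJ, hJ'⟩ := (hσ.down_io y hy).exists_gt (visits w k y)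
  simp only [Set.mem_ofPred_eq] at hJ
  have hbd : ∀ n, ret σ y n ≤ J := by
    intro n
    have h1 := h.visits_eq hσ n y
    have h2 : visits w (hit w (y + 1 + n)) y ≤ J := by
      by_contra! hlt
      rcases le_total k (hit w (y + 1 + n)) with hle | hle
      · have := hup _ hle J hJ'.le hlt
        rw [hJ] at this; simp at this
      · have := Nat.count_monotone (fun i => w i = y) hle
        simp only [visits] at hlt hJ'
        omega
    omega
  obtain ⟨v, hv⟩ : ∃ v, ∀ᶠ n in atTop, ret σ y n = v := by
    have hfin : (Set.range (ret σ y)).Finite :=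
      (Set.finite_Iic J).subset (by rintro _ ⟨n, rfl⟩; exact hbd n)
    have hb : BddAbove (Set.range (ret σ y)) := hfin.bddAbove
    obtain ⟨n, hn⟩ := Nat.sSup_mem (Set.range_nonempty (ret σ y)) hb
    refine ⟨ret σ y n, eventually_atTop.2 ⟨n, fun m hm => le_antisymm ?_ (ret_mono hσ y hm)⟩⟩
    rw [hn]; exact le_csSup hb ⟨m, rfl⟩
  refine ⟨v, visits w k y, hv, hdown, fun i hi hi' => ?_⟩
  -- At a hitting time after `k` when `ret σ y` has its final value, `v + 1` upward instructions
  -- have been used at `y`, and the used ones are downs followed by ups.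
  obtain ⟨n, hn, hn'⟩ := (hv.and ((h.tendsto_hit hσ y).eventually_ge_atTop (k + 1))).exists
  have hlt : i < visits w (hit w (y + 1 + n)) y := by
    refine lt_of_lt_of_le hi' ?_
    have hu := (h.visits_eq hσ n y).1
    rw [hn] at hu
    set M := visits w (hit w (y + 1 + n)) y
    have hkM : visits w k y ≤ M := Nat.count_monotone _ (by omega)
    obtain ⟨d, hd⟩ := Nat.exists_eq_add_of_le hkM
    have hp : Pattern σ y (visits w k y) d :=
      ⟨hdown, fun i h1 h2 => hup (hit w (y + 1 + n)) (by omega) i h1 (by rw [← hd] at h2; exact h2)⟩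
    have := hp.count d le_rfl
    rw [← hd, hu] at this
    omega
  exact hup _ (by omega) i hi hlt

/-- Every site between two successive positions is visited in between. -/
theorem exists_between {w : ℕ → ℕ} (hstep : ∀ k, w (k + 1) = w k + 1 ∨ w (k + 1) + 1 = w k)
    {x i j : ℕ} (hij : i ≤ j) (h : w i ≤ x ∧ x ≤ w j ∨ x ≤ w i ∧ w j ≤ x) :
    ∃ k, i ≤ k ∧ k ≤ j ∧ w k = x := by
  induction j, hij using Nat.le_induction with
  | base => exact ⟨i, le_rfl, le_rfl, by omega⟩
  | succ j hj ih =>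
    by_cases hx : w (j + 1) = x
    · exact ⟨j + 1, by omega, le_rfl, hx⟩
    · obtain ⟨k, h1, h2, h3⟩ := ih (by rcases hstep j with h' | h' <;> omega)
      exact ⟨k, h1, by omega, h3⟩

theorem Driven.isWeakCutpoint (h : Driven σ w) (hσ : Good σ) {x : ℕ}
    (hl : localTime w x = 1) (hu : upTime w x = 1) : IsWeakCutpoint w x := by
  have hstep : ∀ k, w (k + 1) = w k + 1 ∨ w (k + 1) + 1 = w k := fun k => by
    rcases h.step_cases hσ k with ⟨_, h2⟩ | ⟨_, h2⟩ <;> omega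
  obtain ⟨k, hk⟩ := Set.encard_eq_one.1 hl
  obtain ⟨k', hk'⟩ := Set.encard_eq_one.1 hu
  have hkx : ∀ i, w i = x → i = k := fun i hi => by
    have : i ∈ {k | w k = x} := hi
    rw [hk] at this; exact this
  have h1 : w k' = x ∧ w (k' + 1) = x + 1 := by
    have : k' ∈ {k | w k = x ∧ w (k + 1) = x + 1} := by rw [hk']; rfl
    exact this
  obtain rfl := hkx _ h1.1
  refine ⟨k', h1.1, fun i hi => ?_, fun i hi => ?_⟩
  · by_contra! hlt
    obtain ⟨m, _, h3, h4⟩ := exists_between hstep (Nat.zero_le i)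
      (Or.inl ⟨by rw [h.start]; omega, hlt.le⟩)
    have := hkx m h4
    omega
  · by_contra! hlt
    obtain ⟨m, h2, h3, h4⟩ := exists_between hstep (show k' + 1 ≤ i from hi)
      (Or.inr ⟨by omega, hlt.le⟩)
    have := hkx m h4
    omega

end Driven

/-! ### Random stacks -/

open ProbabilityTheory

/-- The law of a bit that is `true` with probability `t`. -/
def bitMeasure (t : unitInterval) : Measure Bool :=
  ENNReal.ofReal t • Measure.dirac true + ENNReal.ofReal (1 - t) • Measure.dirac false

instance (t : unitInterval) : IsProbabilityMeasure (bitMeasure t) := by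
  constructor
  simp only [bitMeasure, Measure.coe_add, Measure.coe_smul, Pi.add_apply, Pi.smul_apply,
    measure_univ, smul_eq_mul, mul_one]
  rw [← ENNReal.ofReal_add t.2.1 (by linarith [t.2.2])]
  simp

/-- Independent bits, those of stack `x` being `true` with probability `p x`. -/
def stackMeasure (p : ℕ → ℝ) : Measure Stacks :=
  Measure.infinitePi fun a : ℕ × ℕ => bitMeasure (Set.projIcc 0 1 zero_le_one (p a.1))

instance (p : ℕ → ℝ) : IsProbabilityMeasure (stackMeasure p) := by
  unfold stackMeasure; infer_instance

/-- Admissible transition probabilities. -/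
structure Admissible (p q : ℕ → ℝ) : Prop where
  p_pos : ∀ x, 0 < p x
  q_zero : q 0 = 0
  q_pos : ∀ x, 1 ≤ x → 0 < q x
  add_eq_one : ∀ x, p x + q x = 1

theorem Admissible.q_nonneg {p q : ℕ → ℝ} (h : Admissible p q) (x : ℕ) : 0 ≤ q x := by
  rcases Nat.eq_zero_or_pos x with rfl | hx
  · exact h.q_zero.ge
  · exact (h.q_pos x hx).le

theorem Admissible.p_le_one {p q : ℕ → ℝ} (h : Admissible p q) (x : ℕ) : p x ≤ 1 := by
  have := h.add_eq_one x
  have := h.q_nonneg x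
  linarith

theorem Admissible.q_lt_one {p q : ℕ → ℝ} (h : Admissible p q) (x : ℕ) : q x < 1 := by
  have := h.add_eq_one x
  have := h.p_pos x
  linarith

theorem Admissible.rho_nonneg {p q : ℕ → ℝ} (h : Admissible p q) (x : ℕ) : 0 ≤ rho p q x :=
  div_nonneg (h.q_nonneg x) (h.p_pos x).le

/-- The probability that a bit at site `x` equals `b`. -/
def bitProb (p q : ℕ → ℝ) (x : ℕ) (b : Bool) : ℝ := if b = true then p x else q x

theorem Admissible.bitProb_nonneg {p q : ℕ → ℝ} (h : Admissible p q) (x : ℕ) (b : Bool) :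
    0 ≤ bitProb p q x b := by
  unfold bitProb; split_ifs
  exacts [(h.p_pos x).le, h.q_nonneg x]

theorem Admissible.bitMeasure_singleton {p q : ℕ → ℝ} (h : Admissible p q) (x : ℕ) (b : Bool) :
    bitMeasure (Set.projIcc 0 1 zero_le_one (p x)) {b} = ENNReal.ofReal (bitProb p q x b) := by
  rw [Set.projIcc_of_mem _ ⟨(h.p_pos x).le, h.p_le_one x⟩]
  have : 1 - p x = q x := by have := h.add_eq_one x; linarith
  cases b <;> simp [bitMeasure, bitProb, this]

theorem Admissible.measure_cylinder {p q : ℕ → ℝ} (h : Admissible p q) (s : Finset (ℕ × ℕ))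
    (b : ℕ × ℕ → Bool) :
    stackMeasure p {σ | ∀ a ∈ s, σ a = b a} =
      ∏ a ∈ s, ENNReal.ofReal (bitProb p q a.1 (b a)) := by
  have : {σ : Stacks | ∀ a ∈ s, σ a = b a} = Set.pi s fun a => {b a} := by
    ext σ; simp [Set.mem_pi]
  rw [this, stackMeasure, Measure.infinitePi_pi _ (fun a _ => measurableSet_singleton _)]
  exact Finset.prod_congr rfl fun a _ => h.bitMeasure_singleton a.1 (b a)

theorem Admissible.measure_bit {p q : ℕ → ℝ} (h : Admissible p q) (a : ℕ × ℕ) (b : Bool) :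
    stackMeasure p {σ | σ a = b} = ENNReal.ofReal (bitProb p q a.1 b) := by
  simpa using h.measure_cylinder {a} (fun _ => b)

/-! ### Independence and measurability in terms of the bits used. -/

/-- The σ-algebra generated by the bits with index in `S`. -/
@[reducible]
def bits (S : Set (ℕ × ℕ)) : MeasurableSpace Stacks :=
  ⨆ a ∈ S, MeasurableSpace.comap (fun σ : Stacks => σ a) inferInstance

theorem bits_le (S : Set (ℕ × ℕ)) : bits S ≤ (inferInstance : MeasurableSpace Stacks) :=
  iSup₂_le fun a _ => (measurable_pi_apply a).comap_le

theorem _root_.MeasurableSet.of_bits {S : Set (ℕ × ℕ)} {A : Set Stacks} (h : MeasurableSet[bits S] A) :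
    MeasurableSet A :=
  bits_le S A h

/-- The indices of the bits in stack `x`. -/
def column (x : ℕ) : ℕ ↪ ℕ × ℕ := ⟨fun i => (x, i), fun _ _ h => (Prod.mk.inj h).2⟩

@[simp] theorem column_apply (x i : ℕ) : column x i = (x, i) := rfl

theorem bits_mono {S T : Set (ℕ × ℕ)} (h : S ⊆ T) : bits S ≤ bits T :=
  biSup_mono h

theorem iIndepFun_bits (p : ℕ → ℝ) :
    iIndepFun (fun (a : ℕ × ℕ) (σ : Stacks) => σ a) (stackMeasure p) := by
  unfold stackMeasure
  exact iIndepFun_infinitePi (X := fun _ b => b) (fun _ => measurable_id)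

theorem measure_inter_bits (p : ℕ → ℝ) {S T : Set (ℕ × ℕ)} (h : Disjoint S T) {A B : Set Stacks}
    (hA : MeasurableSet[bits S] A) (hB : MeasurableSet[bits T] B) :
    stackMeasure p (A ∩ B) = stackMeasure p A * stackMeasure p B := by
  have hI := indep_iSup_of_disjoint (μ := stackMeasure p)
    (fun a => (measurable_pi_apply (X := fun _ : ℕ × ℕ => Bool) a).comap_le) (iIndepFun_bits p) h
  exact (Indep_iff _ _ _).1 hI A B hA hB

theorem measurableSet_bit {S : Set (ℕ × ℕ)} {a : ℕ × ℕ} (ha : a ∈ S) (b : Bool) :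
    MeasurableSet[bits S] {σ : Stacks | σ a = b} := by
  have : MeasurableSpace.comap (fun σ : Stacks => σ a) inferInstance ≤ bits S :=
    le_iSup₂_of_le a ha le_rfl
  exact this _ ⟨{b}, measurableSet_singleton _, rfl⟩

theorem measurableSet_ups {S : Set (ℕ × ℕ)} {x n : ℕ} (h : ∀ i < n, (x, i) ∈ S) (k : ℕ) :
    MeasurableSet[bits S] {σ | ups σ x n = k} := by
  induction n generalizing k with
  | zero =>
    simp only [ups, Nat.count_zero]
    exact MeasurableSet.const _
  | succ n ih =>
    have ih' := fun k => ih (fun i hi => h i (by omega)) k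
    have hb := fun b => measurableSet_bit (h n (by omega)) b
    have : {σ : Stacks | ups σ x (n + 1) = k} =
        ({σ | ups σ x n = k} ∩ {σ | σ (x, n) = false}) ∪
          ⋃ (j : ℕ) (_ : j + 1 = k), ({σ | ups σ x n = j} ∩ {σ | σ (x, n) = true}) := by
      ext σ
      cases hs : σ (x, n) <;> simp [ups, Nat.count_succ, hs]
    rw [this]
    refine MeasurableSet.union ((ih' k).inter (hb _)) ?_
    exact MeasurableSet.iUnion fun j => MeasurableSet.iUnion fun _ => (ih' j).inter (hb _)

theorem measurableSet_fails {S : Set (ℕ × ℕ)} {x : ℕ} (h : ∀ i, (x, i) ∈ S) (v k : ℕ) :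
    MeasurableSet[bits S] {σ | fails σ x v = k} := by
  -- The value `0` is left out here because it is also the default of `Nat.nth` on a stack with too
  -- few ups; it is recovered below as a complement.
  have hpos : ∀ m, 0 < m →
      MeasurableSet[bits S] {σ : Stacks | Nat.nth (fun i => σ (x, i) = true) v = m} := by
    intro m hm
    have : {σ : Stacks | Nat.nth (fun i => σ (x, i) = true) v = m} =
        {σ | σ (x, m) = true} ∩ {σ | ups σ x m = v} := by
      ext σ
      simp only [Set.mem_ofPred_eq, Set.mem_inter_iff]
      constructor
      · rintro rfl
        have hv : ∀ hf : {i | σ (x, i) = true}.Finite, v < hf.toFinset.card := by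
          intro hf
          by_contra! hle
          rw [Nat.nth_of_card_le hf hle] at hm
          omega
        exact ⟨Nat.nth_mem v hv, Nat.count_nth hv⟩
      · rintro ⟨h1, rfl⟩
        exact Nat.nth_count (p := fun i => σ (x, i) = true) h1
    rw [this]
    exact (measurableSet_bit (h m) _).inter (measurableSet_ups (fun i _ => h i) _)
  have hall : ∀ m,
      MeasurableSet[bits S] {σ : Stacks | Nat.nth (fun i => σ (x, i) = true) v = m} := by
    intro m
    rcases Nat.eq_zero_or_pos m with rfl | hm
    · have : {σ : Stacks | Nat.nth (fun i => σ (x, i) = true) v = 0} =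
          (⋃ (m : ℕ) (_ : 0 < m), {σ : Stacks | Nat.nth (fun i => σ (x, i) = true) v = m})ᶜ := by
        ext σ
        simp only [Set.mem_ofPred_eq, Set.mem_compl_iff, Set.mem_iUnion, not_exists]
        exact ⟨fun h0 m hm hm' => by omega, fun h => by
          by_contra h0; exact h _ (Nat.pos_of_ne_zero h0) rfl⟩
      rw [this]
      exact (MeasurableSet.iUnion fun m => MeasurableSet.iUnion fun hm => hpos m hm).compl
    · exact hpos m hm
  have : {σ : Stacks | fails σ x v = k} =
      ⋃ (m : ℕ) (_ : m - v = k), {σ : Stacks | Nat.nth (fun i => σ (x, i) = true) v = m} := by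
    ext σ; simp [fails]
  rw [this]
  exact MeasurableSet.iUnion fun m => MeasurableSet.iUnion fun _ => hall m

theorem measurableSet_ret {S : Set (ℕ × ℕ)} {x n : ℕ}
    (h : ∀ z, x < z → z ≤ x + n → ∀ i, (z, i) ∈ S) (k : ℕ) :
    MeasurableSet[bits S] {σ | ret σ x n = k} := by
  induction n generalizing x k with
  | zero => simp only [ret_zero]; exact MeasurableSet.const _
  | succ n ih =>
    have : {σ | ret σ x (n + 1) = k} =
        ⋃ v, ({σ | ret σ (x + 1) n = v} ∩ {σ | fails σ (x + 1) v = k}) := by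
      ext σ; simp [ret_succ]
    rw [this]
    exact MeasurableSet.iUnion fun v => (ih (fun z h1 h2 => h z (by omega) (by omega)) v).inter
      (measurableSet_fails (h (x + 1) (by omega) (by omega)) v k)

theorem measurableSet_pattern {S : Set (ℕ × ℕ)} {x j u : ℕ} (h : ∀ i < j + u, (x, i) ∈ S) :
    MeasurableSet[bits S] {σ | Pattern σ x j u} := by
  have : {σ | Pattern σ x j u} = (⋂ (i : ℕ) (_ : i < j), {σ | σ (x, i) = false}) ∩
      ⋂ (i : ℕ) (_ : j ≤ i) (_ : i < j + u), {σ | σ (x, i) = true} := by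
    ext σ; simp [Pattern]
  rw [this]
  exact (MeasurableSet.iInter fun i => MeasurableSet.iInter fun hi =>
    measurableSet_bit (h i (by omega)) _).inter
    (MeasurableSet.iInter fun i => MeasurableSet.iInter fun _ => MeasurableSet.iInter fun hi =>
    measurableSet_bit (h i hi) _)

theorem measurableSet_eventually_ret {S : Set (ℕ × ℕ)} {x : ℕ}
    (h : ∀ z, x < z → ∀ i, (z, i) ∈ S) (k : ℕ) :
    MeasurableSet[bits S] {σ | ∀ᶠ n in atTop, ret σ x n = k} := by
  simp only [eventually_atTop]
  have : {σ | ∃ a, ∀ b, a ≤ b → ret σ x b = k} = ⋃ a, ⋂ (b) (_ : a ≤ b), {σ | ret σ x b = k} := by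
    ext σ; simp
  rw [this]
  exact MeasurableSet.iUnion fun a => MeasurableSet.iInter fun b => MeasurableSet.iInter fun _ =>
    measurableSet_ret (fun z hz _ => h z hz) k

/-! ### Exact laws: patterns, negative binomial counts, generating functions. -/

section Law

variable {p q : ℕ → ℝ}

theorem Admissible.measure_pattern (h : Admissible p q) (x j u : ℕ) :
    stackMeasure p {σ | Pattern σ x j u} = ENNReal.ofReal (q x ^ j * p x ^ u) := by
  have : {σ : Stacks | Pattern σ x j u} = {σ | ∀ a ∈ (Finset.range (j + u)).map (column x),
      σ a = decide (j ≤ a.2)} := by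
    ext σ
    simp only [Set.mem_ofPred_eq, Finset.mem_map, Finset.mem_range, forall_exists_index, and_imp,
      forall_apply_eq_imp_iff₂, column_apply]
    constructor
    · rintro ⟨h1, h2⟩ i hi
      rcases Nat.lt_or_ge i j with hij | hij
      · rw [h1 i hij]; simp [hij]
      · rw [h2 i hij hi]; simp [hij]
    · intro h
      exact ⟨fun i hi => by rw [h i (by omega)]; simp [hi],
        fun i hi hi' => by rw [h i hi']; simp [hi]⟩
  rw [this, h.measure_cylinder, Finset.prod_map, Finset.prod_range_add,
    ENNReal.ofReal_mul (pow_nonneg (h.q_nonneg x) _), ENNReal.ofReal_pow (h.q_nonneg x),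
    ENNReal.ofReal_pow (h.p_pos x).le]
  congr 1
  · rw [Finset.prod_congr rfl (g := fun _ => ENNReal.ofReal (q x)), Finset.prod_const,
      Finset.card_range]
    intro i hi
    have : ¬ j ≤ i := by simpa using hi
    simp [bitProb, this]
  · rw [Finset.prod_congr rfl (g := fun _ => ENNReal.ofReal (p x)), Finset.prod_const,
      Finset.card_range]
    intro i _
    simp [bitProb]

theorem Admissible.measure_constant_tail (h : Admissible p q) (x j : ℕ) (b : Bool)
    (hb : bitProb p q x b < 1) :
    stackMeasure p {σ | ∀ i, j ≤ i → σ (x, i) = b} = 0 := by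
  have hle : ∀ n, stackMeasure p {σ | ∀ i, j ≤ i → σ (x, i) = b} ≤
      ENNReal.ofReal (bitProb p q x b) ^ n := by
    intro n
    have := h.measure_cylinder ((Finset.Ico j (j + n)).map (column x)) fun _ => b
    simp only [Finset.prod_map, column_apply, Finset.prod_const, Nat.card_Ico,
      Nat.add_sub_cancel_left] at this
    rw [← this]
    refine measure_mono fun σ hσ a ha => ?_
    obtain ⟨i, hi, rfl⟩ := Finset.mem_map.1 ha
    exact hσ _ (Finset.mem_Ico.1 hi).1
  have ht : Tendsto (fun n : ℕ => ENNReal.ofReal (bitProb p q x b) ^ n) atTop (𝓝 0) :=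
    ENNReal.tendsto_pow_atTop_nhds_zero_of_lt_one (by
      rw [← ENNReal.ofReal_one]; exact (ENNReal.ofReal_lt_ofReal_iff one_pos).2 hb)
  exact le_antisymm (ge_of_tendsto' ht hle) bot_le

theorem Admissible.ae_infinite (h : Admissible p q) (x : ℕ) (b : Bool)
    (hb : bitProb p q x (!b) < 1) :
    ∀ᵐ σ ∂stackMeasure p, {i | σ (x, i) = b}.Infinite := by
  have : ∀ᵐ σ ∂stackMeasure p, ∀ j, ¬ ∀ i, j ≤ i → σ (x, i) = !b :=
    ae_all_iff.2 fun j => (measure_eq_zero_iff_ae_notMem).1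
      (h.measure_constant_tail x j (!b) hb)
  filter_upwards [this] with σ hσ
  rw [Set.infinite_iff_exists_gt]
  intro a
  have := hσ (a + 1)
  push Not at this
  obtain ⟨i, hi, hi'⟩ := this
  exact ⟨i, by simpa using hi', by omega⟩

theorem Admissible.ae_good (h : Admissible p q) : ∀ᵐ σ ∂stackMeasure p, Good σ := by
  have h1 : ∀ᵐ σ ∂stackMeasure p, ∀ x, {i | σ (x, i) = true}.Infinite :=
    ae_all_iff.2 fun x => h.ae_infinite x true (by simpa [bitProb] using h.q_lt_one x)
  have h2 : ∀ᵐ σ ∂stackMeasure p, ∀ x, 1 ≤ x → {i | σ (x, i) = false}.Infinite := by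
    refine ae_all_iff.2 fun x => ?_
    by_cases hx : 1 ≤ x
    · filter_upwards [h.ae_infinite x false (by
        have := h.add_eq_one x
        have := h.q_pos x hx
        simp only [bitProb, Bool.not_false, if_true]; linarith)] with σ hσ _ using hσ
    · exact Eventually.of_forall fun σ hx' => absurd hx' hx
  have h3 : ∀ᵐ σ ∂stackMeasure p, ∀ i, σ (0, i) = true := by
    refine ae_all_iff.2 fun i => ?_
    have := h.measure_bit (0, i) false
    rw [show bitProb p q (0, i).1 false = 0 by simp [bitProb, h.q_zero],
      ENNReal.ofReal_zero] at this
    filter_upwards [measure_eq_zero_iff_ae_notMem.1 this] with σ hσ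
    simpa using hσ
  filter_upwards [h1, h2, h3] with σ h1 h2 h3 using ⟨h1, h2, h3⟩

theorem Admissible.measure_ups (h : Admissible p q) (x n k : ℕ) :
    stackMeasure p {σ | ups σ x n = k} =
      ENNReal.ofReal (n.choose k * p x ^ k * q x ^ (n - k)) := by
  have hp := (h.p_pos x).le
  have hq := h.q_nonneg x
  induction n generalizing k with
  | zero =>
    rcases k with _ | k
    · simp [ups]
    · simp [ups]
  | succ n ih =>
    have hind : ∀ k b, stackMeasure p ({σ | ups σ x n = k} ∩ {σ | σ (x, n) = b}) =
        ENNReal.ofReal (n.choose k * p x ^ k * q x ^ (n - k)) *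
          ENNReal.ofReal (bitProb p q x b) := by
      intro k b
      rw [measure_inter_bits p (S := {a | a.1 = x ∧ a.2 < n}) (T := {(x, n)}) (by simp)
        (measurableSet_ups (fun i hi => by simpa using hi) k) (measurableSet_bit (Set.mem_singleton _) b), ih,
        h.measure_bit]
    have hmeas : ∀ k b, MeasurableSet ({σ | ups σ x n = k} ∩ {σ : Stacks | σ (x, n) = b}) :=
      fun k b => (measurableSet_ups (fun _ _ => Set.mem_univ _) k).of_bits.inter
        (measurableSet_bit (Set.mem_univ _) b).of_bits
    rcases k with _ | k
    · have : {σ : Stacks | ups σ x (n + 1) = 0} =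
          {σ | ups σ x n = 0} ∩ {σ | σ (x, n) = false} := by
        ext σ
        cases hs : σ (x, n) <;> simp [ups, Nat.count_succ, hs]
      rw [this, hind, ← ENNReal.ofReal_mul (by positivity)]
      simp [bitProb, pow_succ]
    · have : {σ : Stacks | ups σ x (n + 1) = k + 1} =
          ({σ | ups σ x n = k + 1} ∩ {σ | σ (x, n) = false}) ∪
            ({σ | ups σ x n = k} ∩ {σ | σ (x, n) = true}) := by
        ext σ
        cases hs : σ (x, n) <;> simp [ups, Nat.count_succ, hs]
      rw [this, measure_union _ (hmeas _ _), hind, hind, ← ENNReal.ofReal_mul (by positivity),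
        ← ENNReal.ofReal_mul (by positivity), ← ENNReal.ofReal_add]
      · congr 1
        simp only [bitProb, if_true, Nat.choose_succ_succ, Nat.cast_add, Bool.false_eq_true,
          if_false]
        rcases Nat.lt_or_ge k n with hkn | hkn
        · obtain ⟨d, rfl⟩ := Nat.exists_eq_add_of_lt hkn
          rw [show k + d + 1 - (k + 1) = d by omega, show k + d + 1 - k = d + 1 by omega,
            show k + d + 1 + 1 - (k + 1) = d + 1 by omega]
          ring
        · rw [Nat.choose_eq_zero_of_lt (show n < k + 1 by omega),
            show n - k = 0 by omega, show n + 1 - (k + 1) = 0 by omega]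
          simp; ring
      · have := h.bitProb_nonneg x false; positivity
      · have := h.bitProb_nonneg x true; positivity
      · rw [Set.disjoint_left]
        rintro σ ⟨_, h1⟩ ⟨_, h2⟩
        simp_all

/-- Negative binomial law: almost surely, `v` of the first `v + k` instructions are upward and so is
the next one. -/
theorem Admissible.measure_fails (h : Admissible p q) (x v k : ℕ) :
    stackMeasure p {σ | fails σ x v = k} =
      ENNReal.ofReal ((v + k).choose v * p x ^ (v + 1) * q x ^ k) := by
  have hp := (h.p_pos x).le
  have hq := h.q_nonneg x
  have hae : {σ | fails σ x v = k} =ᵐ[stackMeasure p]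
      ({σ | ups σ x (v + k) = v} ∩ {σ | σ (x, v + k) = true} : Set Stacks) := by
    rw [Filter.eventuallyEq_set]
    filter_upwards [h.ae_good] with σ hσ
    simp only [Set.mem_inter_iff, Set.mem_ofPred_eq]
    have hinf := hσ.up_io x
    have hle : v ≤ Nat.nth (fun i => σ (x, i) = true) v :=
      (Nat.nth_strictMono hinf).le_apply
    constructor
    · intro hk
      have : Nat.nth (fun i => σ (x, i) = true) v = v + k := by
        unfold fails at hk; omega
      rw [← this]
      exact ⟨Nat.count_nth_of_infinite hinf v, Nat.nth_mem_of_infinite hinf v⟩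
    · rintro ⟨h1, h2⟩
      have := Nat.nth_count (p := fun i => σ (x, i) = true) h2
      simp only [ups] at h1
      rw [h1] at this
      unfold fails
      omega
  rw [measure_congr hae, measure_inter_bits p (S := {a | a.1 = x ∧ a.2 < v + k})
    (T := {(x, v + k)}) (by simp) (measurableSet_ups (fun i hi => by simpa using hi) _)
    (measurableSet_bit (Set.mem_singleton _) _), h.measure_ups, h.measure_bit, ← ENNReal.ofReal_mul (by positivity)]
  congr 1
  simp only [bitProb, if_true, show v + k - v = k by omega]
  ring

theorem Admissible.tsum_fails (h : Admissible p q) (x v : ℕ) {s : ℝ} (hs : 0 ≤ s) (hs' : s ≤ 1) :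
    ∑' k, stackMeasure p {σ | fails σ x v = k} * ENNReal.ofReal s ^ k =
      ENNReal.ofReal (p x / (1 - q x * s)) ^ (v + 1) := by
  have hp := (h.p_pos x).le
  have hq := h.q_nonneg x
  have hlt : q x * s < 1 := lt_of_le_of_lt (mul_le_of_le_one_right hq hs') (h.q_lt_one x)
  have hsum := hasSum_choose_mul_geometric_of_norm_lt_one v (r := q x * s)
    (by rw [Real.norm_of_nonneg (by positivity)]; exact hlt)
  have hsum' := hsum.mul_left (p x ^ (v + 1))
  have hcalc : ∀ k, stackMeasure p {σ | fails σ x v = k} * ENNReal.ofReal s ^ k =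
      ENNReal.ofReal (p x ^ (v + 1) * (((k + v).choose v : ℝ) * (q x * s) ^ k)) := by
    intro k
    rw [h.measure_fails, ← ENNReal.ofReal_pow hs, ← ENNReal.ofReal_mul (by positivity)]
    congr 1
    rw [mul_pow, add_comm v k]
    ring
  simp_rw [hcalc]
  rw [← ENNReal.ofReal_tsum_of_nonneg (fun k => by positivity) hsum'.summable, hsum'.tsum_eq,
    ← ENNReal.ofReal_pow (div_nonneg hp (by linarith)), div_pow]
  congr 1
  ring

theorem Dfin_succ (p q : ℕ → ℝ) (x n : ℕ) :
    Dfin p q x (x + 1 + (n + 1)) = 1 + rho p q (x + 1) * Dfin p q (x + 1) (x + 1 + 1 + n) := by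
  unfold Dfin
  rw [show x + 1 + (n + 1) - x = n + 1 + 1 by omega,
    show x + 1 + 1 + n - (x + 1) = n + 1 by omega, Finset.sum_range_succ', add_comm,
    Finset.mul_sum, Finset.prod_range_zero]
  congr 1
  · refine Finset.sum_congr rfl fun j _ => ?_
    rw [Finset.prod_range_succ', mul_comm]
    congr 1
    refine Finset.prod_congr rfl fun i _ => ?_
    congr 1; omega

theorem Admissible.one_le_Dfin (h : Admissible p q) (x n : ℕ) :
    1 ≤ Dfin p q x (x + 1 + n) := by
  unfold Dfin
  rw [show x + 1 + n - x = n + 1 by omega, Finset.sum_range_succ']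
  rw [Finset.prod_range_zero]
  have : 0 ≤ ∑ k ∈ Finset.range n, ∏ i ∈ Finset.range (k + 1), rho p q (x + 1 + i) :=
    Finset.sum_nonneg fun j _ => Finset.prod_nonneg fun i _ => h.rho_nonneg _
  linarith

/-- Conditioning on the stacks above `x + 1` replaces `s` by `φ = p / (1 - q s)`, the geometric
generating function, with an extra factor `φ` for the immigrant. The linear fractional form
survives, its coefficient changing by `D ↦ 1 + ρ D` as in `Dfin_succ`. -/
theorem Admissible.tsum_ret (h : Admissible p q) (x n : ℕ) {s : ℝ} (hs : 0 ≤ s) (hs' : s ≤ 1) :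
    ∑' k, stackMeasure p {σ | ret σ x n = k} * ENNReal.ofReal s ^ k =
      ENNReal.ofReal (1 / (s + (1 - s) * Dfin p q x (x + 1 + n))) := by
  induction n generalizing x s with
  | zero =>
    rw [tsum_eq_single 0]
    · simp [Dfin]
    · intro k hk
      have : {σ : Stacks | ret σ x 0 = k} = ∅ := by
        ext σ; simp [Ne.symm hk]
      rw [this]; simp
  | succ n ih =>
    have hp := h.p_pos (x + 1)
    have hq := h.q_nonneg (x + 1)
    have hpq := h.add_eq_one (x + 1)
    have hconv : ∀ k, stackMeasure p {σ | ret σ x (n + 1) = k} =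
        ∑' v, stackMeasure p {σ | ret σ (x + 1) n = v} *
          stackMeasure p {σ | fails σ (x + 1) v = k} := by
      intro k
      have : {σ | ret σ x (n + 1) = k} =
          ⋃ v, ({σ | ret σ (x + 1) n = v} ∩ {σ | fails σ (x + 1) v = k}) := by
        ext σ; simp [ret_succ]
      rw [this, measure_iUnion]
      · refine tsum_congr fun v => ?_
        exact measure_inter_bits p (S := {a | x + 1 < a.1}) (T := {a | a.1 = x + 1})
          (by rw [Set.disjoint_left]; intro a h1 h2; simp only [Set.mem_ofPred_eq] at h1 h2; omega)
          (measurableSet_ret (fun z hz _ i => hz) v) (measurableSet_fails (fun i => rfl) v k)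
      · intro v v' hv
        rw [Function.onFun, Set.disjoint_left]
        rintro σ ⟨h1, _⟩ ⟨h2, _⟩
        exact hv (by rw [← (h1 : ret σ (x + 1) n = v), ← (h2 : ret σ (x + 1) n = v')])
      · intro v
        exact (measurableSet_ret (fun _ _ _ _ => Set.mem_univ _) v).of_bits.inter
          (measurableSet_fails (fun _ => Set.mem_univ _) v k).of_bits
    simp_rw [hconv, ← ENNReal.tsum_mul_right]
    rw [ENNReal.tsum_comm]
    simp_rw [mul_assoc, ENNReal.tsum_mul_left, h.tsum_fails _ _ hs hs']
    have hden : 0 < 1 - q (x + 1) * s := by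
      have := mul_le_of_le_one_right hq hs'
      have := h.q_lt_one (x + 1)
      linarith
    set φ : ℝ := p (x + 1) / (1 - q (x + 1) * s) with hφ
    have hφ0 : 0 ≤ φ := by positivity
    have hφ1 : φ ≤ 1 := by
      rw [hφ, div_le_one hden]
      have := mul_le_of_le_one_right hq hs'
      linarith
    simp_rw [pow_succ, ← mul_assoc, ENNReal.tsum_mul_right]
    have hD := h.one_le_Dfin (x + 1) n
    have hrho := h.rho_nonneg (x + 1)
    rw [ih (x + 1) hφ0 hφ1, Dfin_succ, ← ENNReal.ofReal_mul]
    · congr 1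
      set d := Dfin p q (x + 1) (x + 1 + 1 + n)
      have h1φ : 1 - φ = q (x + 1) * (1 - s) / (1 - q (x + 1) * s) := by
        rw [hφ]; field_simp; linarith
      rw [h1φ]
      have hr : rho p q (x + 1) = q (x + 1) / p (x + 1) := rfl
      have e1 : φ + q (x + 1) * (1 - s) / (1 - q (x + 1) * s) * d =
          (p (x + 1) + q (x + 1) * (1 - s) * d) / (1 - q (x + 1) * s) := by
        rw [hφ]; ring
      have e2 : s + (1 - s) * (1 + rho p q (x + 1) * d) =
          (p (x + 1) + q (x + 1) * (1 - s) * d) / p (x + 1) := by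
        rw [hr]; field_simp; ring
      have hpos : 0 < p (x + 1) + q (x + 1) * (1 - s) * d := by
        have : 0 ≤ q (x + 1) * (1 - s) * d :=
          mul_nonneg (mul_nonneg hq (by linarith)) (by linarith)
        linarith
      rw [e1, e2, hφ]
      field_simp
    · have : 0 ≤ (1 - φ) * Dfin p q (x + 1) (x + 1 + 1 + n) :=
        mul_nonneg (by linarith) (by linarith)
      positivity

theorem Admissible.measure_ret_zero (h : Admissible p q) (x n : ℕ) :
    stackMeasure p {σ | ret σ x n = 0} = ENNReal.ofReal (1 / Dfin p q x (x + 1 + n)) := by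
  have := h.tsum_ret x n le_rfl zero_le_one
  -- At `s = 0` only the term `k = 0` survives, because `0 ^ 0 = 1`.
  rw [tsum_eq_single 0 (fun k hk => by simp [hk])] at this
  simpa using this

theorem Admissible.measure_eventually_ret_zero (h : Admissible p q) (x : ℕ) :
    stackMeasure p {σ | ∀ᶠ n in atTop, ret σ x n = 0} = (D p q x)⁻¹ := by
  have hmeas : ∀ n, MeasurableSet {σ | ret σ x n = 0} := fun n =>
    (measurableSet_ret (fun _ _ _ _ => Set.mem_univ _) 0).of_bits
  have hae : {σ | ∀ᶠ n in atTop, ret σ x n = 0} =ᵐ[stackMeasure p]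
      {σ | ∀ n, ret σ x n = 0} := by
    filter_upwards [h.ae_good] with σ hσ
    exact propext (eventually_ret_zero_iff hσ x)
  have hae' : ∀ n, (⋂ m, ⋂ (_ : m ≤ n), {σ | ret σ x m = 0}) =ᵐ[stackMeasure p]
      {σ | ret σ x n = 0} := by
    intro n
    rw [Filter.eventuallyEq_set]
    filter_upwards [h.ae_good] with σ hσ
    simp only [Set.mem_iInter, Set.mem_ofPred_eq]
    refine ⟨fun h => h n le_rfl, fun h m hm => ?_⟩
    have := ret_mono hσ x hm
    omega
  rw [measure_congr hae]
  have hI : {σ | ∀ n, ret σ x n = 0} = ⋂ n, {σ | ret σ x n = 0} := by ext; simp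
  rw [hI]
  have ht := tendsto_measure_iInter_le (μ := stackMeasure p)
    (f := fun n => {σ | ret σ x n = 0}) (fun n => (hmeas n).nullMeasurableSet)
    ⟨0, measure_ne_top _ _⟩
  have ht2 : Tendsto (fun n => (ENNReal.ofReal (Dfin p q x (x + 1 + n)))⁻¹) atTop
      (𝓝 (D p q x)⁻¹) := by
    have h1 := tendsto_Dfin p q (fun k => (h.p_pos k).le) h.q_nonneg x
    have h2 : Tendsto (fun n => x + 1 + n) atTop atTop :=
      tendsto_atTop_mono (fun n => show n ≤ x + 1 + n by omega) tendsto_id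
    exact (tendsto_inv_iff.2 (h1.comp h2))
  refine tendsto_nhds_unique ht (ht2.congr fun n => ?_)
  rw [measure_congr (hae' n), h.measure_ret_zero, one_div, ENNReal.ofReal_inv_of_pos]
  have := h.one_le_Dfin x n
  linarith

end Law

/-! ### The walk driven by random stacks -/

/-- Position and visit counts of the driven walk. -/
def walkState (σ : Stacks) : ℕ → ℕ × (ℕ → ℕ)
  | 0 => (0, fun _ => 0)
  | k + 1 =>
    (if σ ((walkState σ k).1, (walkState σ k).2 (walkState σ k).1) = true
      then (walkState σ k).1 + 1 else (walkState σ k).1 - 1,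
      fun x => (walkState σ k).2 x + if (walkState σ k).1 = x then 1 else 0)

/-- The walk driven by `σ`. -/
def walk (σ : Stacks) (k : ℕ) : ℕ := (walkState σ k).1

theorem walkState_snd (σ : Stacks) (k x : ℕ) : (walkState σ k).2 x = visits (walk σ) k x := by
  induction k with
  | zero => simp [walkState, visits]
  | succ k ih => rw [visits_succ, ← ih]; rfl

theorem driven_walk (σ : Stacks) : Driven σ (walk σ) where
  start := rfl
  step k := by rw [← walkState_snd]; rfl

theorem visits_congr {w s : ℕ → ℕ} {k : ℕ} (h : ∀ i ≤ k, w i = s i) (x : ℕ) :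
    visits w k x = visits s k x := by
  simp only [visits, Nat.count_eq_card_filter_range]
  congr 1
  refine Finset.filter_congr fun i hi => ?_
  rw [h i (by simp at hi; omega)]

theorem walk_cylinder_step (s : ℕ → ℕ) (k y : ℕ) :
    {σ | (∀ i ≤ k, walk σ i = s i) ∧ walk σ (k + 1) = y} =
      {σ | ∀ i ≤ k, walk σ i = s i} ∩
        {σ | (if σ (s k, visits s k (s k)) = true then s k + 1 else s k - 1) = y} := by
  ext σ
  simp only [Set.mem_ofPred_eq, Set.mem_inter_iff]
  refine and_congr_right fun h => ?_
  rw [(driven_walk σ).step k, h k le_rfl, visits_congr h]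

theorem measurableSet_step {S : Set (ℕ × ℕ)} {a : ℕ × ℕ} (ha : a ∈ S) (x y : ℕ) :
    MeasurableSet[bits S] {σ : Stacks | (if σ a = true then x + 1 else x - 1) = y} := by
  have : {σ : Stacks | (if σ a = true then x + 1 else x - 1) = y} =
      (⋃ (_ : x + 1 = y), {σ | σ a = true}) ∪ ⋃ (_ : x - 1 = y), {σ | σ a = false} := by
    ext σ
    cases h : σ a <;> simp [h]
  rw [this]
  exact (MeasurableSet.iUnion fun _ => measurableSet_bit ha _).union
    (MeasurableSet.iUnion fun _ => measurableSet_bit ha _)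

theorem setOf_forall_le_succ {Ω : Type*} (X : ℕ → Ω → ℕ) (s : ℕ → ℕ) (k : ℕ) :
    {ω | ∀ i ≤ k + 1, X i ω = s i} =
      {ω | (∀ i ≤ k, X i ω = s i) ∧ X (k + 1) ω = s (k + 1)} := by
  ext ω
  simp only [Set.mem_ofPred_eq]
  refine ⟨fun h => ⟨fun i hi => h i (by omega), h _ le_rfl⟩, fun h i hi => ?_⟩
  rcases Nat.lt_or_ge i (k + 1) with hlt | hge
  · exact h.1 i (by omega)
  · rw [show i = k + 1 by omega]; exact h.2

/-- Up to time `k` a path consumes from each stack only the instructions numbered below its visit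
count. The next one is fresh, hence independent of the past, which is the Markov property. -/
theorem measurableSet_walk_cylinder (s : ℕ → ℕ) (k : ℕ) :
    MeasurableSet[bits {a | a.2 < visits s k a.1}] {σ | ∀ i ≤ k, walk σ i = s i} := by
  induction k with
  | zero =>
    have : {σ : Stacks | ∀ i ≤ 0, walk σ i = s i} = {_σ | 0 = s 0} := by
      ext σ; simp [walk, walkState]
    rw [this]
    exact MeasurableSet.const _
  | succ k ih =>
    rw [setOf_forall_le_succ (fun i σ => walk σ i), walk_cylinder_step]
    refine MeasurableSet.inter ?_ (measurableSet_step ?_ _ _)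
    · refine bits_mono ?_ _ ih
      intro a ha
      simp only [Set.mem_ofPred_eq] at ha ⊢
      rw [visits_succ]
      omega
    · simp [visits_succ]

theorem measurable_walk (k : ℕ) : Measurable fun σ => walk σ k := by
  refine measurable_to_countable' fun y => ?_
  have : (fun σ => walk σ k) ⁻¹' {y} = ⋃ (l : Fin (k + 1) → ℕ) (_ : l (Fin.last k) = y),
      {σ | ∀ i ≤ k, walk σ i = (fun i => if h : i < k + 1 then l ⟨i, h⟩ else 0) i} := by
    ext σ
    simp only [Set.mem_preimage, Set.mem_singleton_iff, Set.mem_iUnion, Set.mem_ofPred_eq]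
    constructor
    · intro h
      refine ⟨fun i => walk σ i, by simpa using h, fun i hi => ?_⟩
      simp [show i < k + 1 by omega]
    · rintro ⟨l, hl, h⟩
      have := h k le_rfl
      rw [this, ← hl]
      simp [Fin.last]
  rw [this]
  exact MeasurableSet.iUnion fun l => MeasurableSet.iUnion fun _ =>
    (measurableSet_walk_cylinder _ k).of_bits

theorem Admissible.isWalk {p q : ℕ → ℝ} (h : Admissible p q) :
    IsWalk (stackMeasure p) p q fun k σ => walk σ k where
  measurable := measurable_walk
  start := Eventually.of_forall fun _ => rfl
  markov k s y := by
    rw [walk_cylinder_step, measure_inter_bits p (T := {(s k, visits s k (s k))}) (by simp)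
      (measurableSet_walk_cylinder s k) (measurableSet_step (Set.mem_singleton _) _ _)]
    congr 1
    have ht := h.measure_bit (s k, visits s k (s k)) true
    have hf := h.measure_bit (s k, visits s k (s k)) false
    simp only [bitProb, if_true, Bool.false_eq_true, if_false] at ht hf
    unfold trans
    generalize (s k, visits s k (s k)) = a at ht hf
    generalize s k = x at ht hf
    split_ifs with h1 h2
    · rw [← ht]
      congr 1; ext σ
      cases hs : σ a <;> simp [hs, h1]
    · rw [← hf]
      congr 1; ext σ
      cases hs : σ a <;> simp [hs] <;> omega
    -- At `0` the truncated difference `0 - 1` would leave the walk in place, but the bit causing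
    -- this has probability `q 0 = 0`.
    · rcases Nat.eq_zero_or_pos x with rfl | hx
      · rw [h.q_zero, ENNReal.ofReal_zero] at hf
        rw [ENNReal.ofReal_zero]
        refine measure_mono_null (fun σ hσ => ?_) hf
        simp only [Set.mem_ofPred_eq] at hσ ⊢
        by_contra hc
        simp only [Bool.not_eq_false] at hc
        simp [hc] at hσ
        omega
      · have : {σ : Stacks | (if σ a = true then x + 1 else x - 1) = y} = ∅ := by
          ext σ
          cases hs : σ a <;> simp [hs] <;> omega
        rw [this]; simp

/-! ### Uniqueness of the law -/

section Unique

variable {p q : ℕ → ℝ}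

/-- Sets of paths with prescribed values at the times `0, …, k`. -/
def cylinders : Set (Set (ℕ → ℕ)) := {C | ∃ (k : ℕ) (s : ℕ → ℕ), C = {w | ∀ i ≤ k, w i = s i}}

theorem measurableSet_eval (k x : ℕ) : MeasurableSet {w : ℕ → ℕ | w k = x} :=
  measurable_pi_apply (X := fun _ : ℕ => ℕ) k (measurableSet_singleton x)

theorem isPiSystem_cylinders : IsPiSystem cylinders := by
  rintro _ ⟨k, s, rfl⟩ _ ⟨l, t, rfl⟩ ⟨w, hw1, hw2⟩
  refine ⟨max k l, w, ?_⟩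
  ext v
  simp only [Set.mem_inter_iff, Set.mem_ofPred_eq] at *
  constructor
  · rintro ⟨h1, h2⟩ i hi
    rcases le_max_iff.1 hi with hi | hi
    · rw [h1 i hi, hw1 i hi]
    · rw [h2 i hi, hw2 i hi]
  · intro h
    exact ⟨fun i hi => by rw [h i (le_max_of_le_left hi), hw1 i hi],
      fun i hi => by rw [h i (le_max_of_le_right hi), hw2 i hi]⟩

theorem generateFrom_cylinders :
    (inferInstance : MeasurableSpace (ℕ → ℕ)) = MeasurableSpace.generateFrom cylinders := by
  apply le_antisymm
  · refine iSup_le fun k => ?_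
    suffices hm : Measurable[MeasurableSpace.generateFrom cylinders] fun w : ℕ → ℕ => w k from
      hm.comap_le
    let := MeasurableSpace.generateFrom cylinders
    refine measurable_to_countable' fun y => ?_
    have : (fun w : ℕ → ℕ => w k) ⁻¹' {y} = ⋃ (l : Fin (k + 1) → ℕ) (_ : l (Fin.last k) = y),
        {w | ∀ i ≤ k, w i = (fun i => if h : i < k + 1 then l ⟨i, h⟩ else 0) i} := by
      ext w
      simp only [Set.mem_preimage, Set.mem_singleton_iff, Set.mem_iUnion, Set.mem_ofPred_eq]
      constructor
      · intro h
        refine ⟨fun i => w i, by simpa using h, fun i hi => ?_⟩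
        simp [show i < k + 1 by omega]
      · rintro ⟨l, hl, h⟩
        have := h k le_rfl
        rw [this, ← hl]
        simp [Fin.last]
    rw [this]
    exact MeasurableSet.iUnion fun l => MeasurableSet.iUnion fun _ =>
      MeasurableSpace.measurableSet_generateFrom ⟨k, _, rfl⟩
  · refine MeasurableSpace.generateFrom_le ?_
    rintro _ ⟨k, s, rfl⟩
    have : {w : ℕ → ℕ | ∀ i ≤ k, w i = s i} = ⋂ (i) (_ : i ≤ k), {w | w i = s i} := by
      ext; simp
    rw [this]
    exact MeasurableSet.iInter fun i => MeasurableSet.iInter fun _ => measurableSet_eval i _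

theorem IsWalk.measure_start {Ω : Type*} [MeasurableSpace Ω] {μ : Measure Ω}
    [IsProbabilityMeasure μ] {X : ℕ → Ω → ℕ} (hX : IsWalk μ p q X) (s : ℕ → ℕ) :
    μ {ω | ∀ i ≤ 0, X i ω = s i} = if s 0 = 0 then 1 else 0 := by
  split_ifs with h
  · rw [← measure_univ (μ := μ)]
    refine measure_congr ?_
    rw [Filter.eventuallyEq_set]
    filter_upwards [hX.start] with ω hω
    simp [hω, h]
  · refine measure_eq_zero_iff_ae_notMem.2 ?_
    filter_upwards [hX.start] with ω hω hc
    exact h (by rw [← hc 0 le_rfl, hω])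

theorem IsWalk.measure_cylinder_eq {Ω Ω' : Type*} [MeasurableSpace Ω] [MeasurableSpace Ω']
    {μ : Measure Ω} {ν : Measure Ω'} [IsProbabilityMeasure μ] [IsProbabilityMeasure ν]
    {X : ℕ → Ω → ℕ} {Y : ℕ → Ω' → ℕ} (hX : IsWalk μ p q X) (hY : IsWalk ν p q Y) (s : ℕ → ℕ)
    (k : ℕ) : μ {ω | ∀ i ≤ k, X i ω = s i} = ν {ω | ∀ i ≤ k, Y i ω = s i} := by
  induction k with
  | zero =>
    rw [hX.measure_start, hY.measure_start]
  | succ k ih =>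
    rw [setOf_forall_le_succ, setOf_forall_le_succ, hX.markov, hY.markov, ih]

theorem IsWalk.map_eq {Ω Ω' : Type*} [MeasurableSpace Ω] [MeasurableSpace Ω']
    {μ : Measure Ω} {ν : Measure Ω'} [IsProbabilityMeasure μ] [IsProbabilityMeasure ν]
    {X : ℕ → Ω → ℕ} {Y : ℕ → Ω' → ℕ} (hX : IsWalk μ p q X) (hY : IsWalk ν p q Y) :
    μ.map (fun ω k => X k ω) = ν.map (fun ω k => Y k ω) := by
  have mX : Measurable fun ω k => X k ω := measurable_pi_lambda _ hX.measurable
  have mY : Measurable fun ω k => Y k ω := measurable_pi_lambda _ hY.measurable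
  have := Measure.isProbabilityMeasure_map (μ := μ) mX.aemeasurable
  have := Measure.isProbabilityMeasure_map (μ := ν) mY.aemeasurable
  refine ext_of_generate_finite cylinders generateFrom_cylinders isPiSystem_cylinders ?_ (by simp)
  rintro C hC
  have hmC : MeasurableSet C := by
    have := MeasurableSpace.measurableSet_generateFrom hC
    rwa [← generateFrom_cylinders] at this
  rw [Measure.map_apply mX hmC, Measure.map_apply mY hmC]
  obtain ⟨k, s, rfl⟩ := hC
  exact hX.measure_cylinder_eq hY s k

/-- Almost sure properties of paths may be checked on the driven walk. -/
theorem IsWalk.ae_of_driven {Ω : Type*} [MeasurableSpace Ω] {μ : Measure Ω}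
    [IsProbabilityMeasure μ] {X : ℕ → Ω → ℕ} (h : Admissible p q) (hX : IsWalk μ p q X)
    {P : Set (ℕ → ℕ)} (hP : MeasurableSet P) (hae : ∀ᵐ σ ∂stackMeasure p, walk σ ∈ P) :
    ∀ᵐ ω ∂μ, (fun k => X k ω) ∈ P := by
  have mX : Measurable fun ω k => X k ω := measurable_pi_lambda _ hX.measurable
  have mY : Measurable walk := measurable_pi_lambda _ measurable_walk
  refine ae_of_ae_map (p := (· ∈ P)) mX.aemeasurable ?_
  rw [hX.map_eq h.isWalk]
  exact (ae_map_iff mY.aemeasurable hP).2 hae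

end Unique

/-! ### Measurability of path events -/

theorem encard_eq_iff_exists_finset (S : Set ℕ) (a : ℕ) :
    S.encard = a ↔ ∃ T : Finset ℕ, T.card = a ∧ ∀ k, k ∈ T ↔ k ∈ S := by
  constructor
  · intro h
    have hf : S.Finite := Set.finite_of_encard_eq_coe h
    refine ⟨hf.toFinset, ?_, fun k => hf.mem_toFinset⟩
    rw [hf.encard_eq_coe_toFinset_card] at h
    exact_mod_cast h
  · rintro ⟨T, hT, h⟩
    have : S = ↑T := by ext k; exact (h k).symm
    rw [this, Set.encard_coe_eq_coe_finsetCard, hT]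

theorem measurableSet_encard_eq {S : (ℕ → ℕ) → Set ℕ}
    (h : ∀ k, MeasurableSet {w | k ∈ S w}) (a : ℕ) : MeasurableSet {w | (S w).encard = a} := by
  simp_rw [encard_eq_iff_exists_finset]
  have : {w | ∃ T : Finset ℕ, T.card = a ∧ ∀ k, k ∈ T ↔ k ∈ S w} =
      ⋃ (T : Finset ℕ) (_ : T.card = a), ⋂ k, {w | k ∈ T ↔ k ∈ S w} := by
    ext w; simp
  rw [this]
  refine MeasurableSet.iUnion fun T => MeasurableSet.iUnion fun _ => MeasurableSet.iInter fun k => ?_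
  by_cases hk : k ∈ T
  · simpa [hk] using h k
  · have : {w | k ∈ T ↔ k ∈ S w} = {w | k ∈ S w}ᶜ := by ext w; simp [hk]
    rw [this]
    exact (h k).compl

theorem measurableSet_localTime (x m : ℕ) : MeasurableSet {w | localTime w x = m} :=
  measurableSet_encard_eq (S := fun w => {k | w k = x}) (fun k => measurableSet_eval k x) m

theorem measurableSet_upTime (x a : ℕ) : MeasurableSet {w | upTime w x = a} :=
  measurableSet_encard_eq (S := fun w => {k | w k = x ∧ w (k + 1) = x + 1})
    (fun k => (measurableSet_eval k x).inter (measurableSet_eval (k + 1) (x + 1))) a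

theorem measurableSet_isWeakCutpoint (x : ℕ) : MeasurableSet {w | IsWeakCutpoint w x} := by
  have : {w | IsWeakCutpoint w x} = ⋃ k, ({w : ℕ → ℕ | w k = x} ∩
      ((⋂ (i) (_ : i < k), {w | w i ≤ x}) ∩ ⋂ (i) (_ : k < i), {w | x ≤ w i})) := by
    ext w; simp [IsWeakCutpoint]
  rw [this]
  exact MeasurableSet.iUnion fun k => (measurableSet_eval k x).inter
    ((MeasurableSet.iInter fun i => MeasurableSet.iInter fun _ =>
      measurable_pi_apply i measurableSet_Iic).inter
    (MeasurableSet.iInter fun i => MeasurableSet.iInter fun _ =>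
      measurable_pi_apply i measurableSet_Ici))

theorem measurableSet_finite {S : (ℕ → ℕ) → Set ℕ} (h : ∀ k, MeasurableSet {w | k ∈ S w}) :
    MeasurableSet {w | (S w).Finite} := by
  have : {w | (S w).Finite} = ⋃ n, ⋂ (k) (_ : n < k), {w | k ∈ S w}ᶜ := by
    ext w
    simp only [Set.mem_ofPred_eq, Set.mem_iUnion, Set.mem_iInter, Set.mem_compl_iff]
    constructor
    · intro hf
      obtain ⟨n, hn⟩ := hf.bddAbove
      exact ⟨n, fun k hk hk' => absurd (hn hk') (by omega)⟩
    · rintro ⟨n, hn⟩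
      exact (Set.finite_Iic n).subset fun k hk => by
        by_contra hc
        exact hn k (by simpa using hc) hk
  rw [this]
  exact MeasurableSet.iUnion fun n => MeasurableSet.iInter fun k => MeasurableSet.iInter fun _ =>
    (h k).compl

/-! ### Convergent case -/

section Convergent

variable {p q : ℕ → ℝ}

theorem Admissible.Dfin_le (h : Admissible p q) {x : ℕ} (hρ : ∀ k, x < k → rho p q k ≤ 1) (n : ℕ) :
    Dfin p q x (x + 1 + n) ≤ n + 1 := by
  unfold Dfin
  rw [show x + 1 + n - x = n + 1 by omega]
  calc _ ≤ ∑ _j ∈ Finset.range (n + 1), (1 : ℝ) := Finset.sum_le_sum fun j _ =>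
        Finset.prod_le_one (fun i _ => h.rho_nonneg _) fun i _ => hρ _ (by omega)
    _ = n + 1 := by simp

/-- A reversed harmonic sum. Its terms bound from below the chances of no return to `x` as seen from
`y`, and they produce the logarithm of the criterion. -/
theorem log_le_sum_Ico (l y : ℕ) :
    Real.log ((y - l : ℕ) + 1) ≤ ∑ x ∈ Finset.Ico l y, (1 : ℝ) / ((y - 1 - x : ℕ) + 1) := by
  have h := log_add_one_le_harmonic (y - l)
  rw [harmonic] at h
  push_cast at h
  refine h.trans (le_of_eq ?_)
  rw [Finset.sum_Ico_eq_sum_range, ← Finset.sum_range_reflect]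
  refine Finset.sum_congr rfl fun i hi => ?_
  have hi := Finset.mem_range.1 hi
  rw [one_div, show y - 1 - (l + i) = y - l - 1 - i by omega]

/-- `B y` is determined by the stacks at `y` and above, and given `B y` and the stacks above `y`
there is a chance of at least `c` that the walk does not step from `y` to `y - 1` once it has been
at `y`. -/
structure Splitting (p : ℕ → ℝ) (B : ℕ → Set Stacks) (c : ℝ≥0∞) (K : ℕ) : Prop where
  meas : ∀ y, MeasurableSet[bits {a | y ≤ a.1}] (B y)
  split : ∀ y, K ≤ y → ∀ G, MeasurableSet[bits {a | y + 1 < a.1}] G →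
    c * stackMeasure p (B (y + 1) ∩ G) ≤
      stackMeasure p (B (y + 1) ∩ G ∩ {σ | ∀ᶠ n in atTop, ret σ y n = 0})

theorem measurableSet_escape (x : ℕ) :
    MeasurableSet[bits {a | x + 1 ≤ a.1}] {σ | ∀ᶠ n in atTop, ret σ x n = 0} :=
  measurableSet_eventually_ret (fun _ hz _ => hz) 0

/-- The event that `y` is the last element of `(_, M]` for which `B` occurs. -/
def lastEvent (B : ℕ → Set Stacks) (M y : ℕ) : Set Stacks :=
  B y ∩ ⋂ (z : ℕ) (_ : y < z) (_ : z ≤ M), (B z)ᶜ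

/-- At the cost of `c`, the edge below `y` is never crossed downwards. What happens at `x` is then
decided by the stacks strictly between `x` and `y`, independent of `lastEvent`, and contributes `1 /
D(x, y) ≥ 1 / (y - x)`. -/
theorem Splitting.lastEvent_inter (h : Admissible p q) {B : ℕ → Set Stacks} {c : ℝ≥0∞} {K : ℕ}
    (hB : Splitting p B c K) (hρ : ∀ k, K < k → rho p q k ≤ 1) {x y M : ℕ} (hx : K ≤ x)
    (hxy : x < y) :
    c * ENNReal.ofReal (1 / ((y - 1 - x : ℕ) + 1)) * stackMeasure p (lastEvent B M y) ≤
      stackMeasure p (lastEvent B M y ∩ {σ | ∀ᶠ n in atTop, ret σ x n = 0}) := by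
  obtain ⟨d, rfl⟩ : ∃ d, y = x + d + 1 := ⟨y - x - 1, by omega⟩
  have hG : MeasurableSet[bits {a | x + d + 1 < a.1}]
      (⋂ (z : ℕ) (_ : x + d + 1 < z) (_ : z ≤ M), (B z)ᶜ) := by
    refine MeasurableSet.iInter fun z => MeasurableSet.iInter fun hz => MeasurableSet.iInter
      fun _ => (bits_mono ?_ _ (hB.meas z)).compl
    intro a ha
    simp only [Set.mem_ofPred_eq] at ha ⊢
    omega
  have h1 := hB.split (x + d) (by omega) _ hG
  set L := lastEvent B M (x + d + 1) with hL
  have hLdef : B (x + d + 1) ∩ (⋂ (z : ℕ) (_ : x + d + 1 < z) (_ : z ≤ M), (B z)ᶜ) = L := rfl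
  rw [hLdef] at h1
  have hLm : MeasurableSet[bits {a | x + d + 1 ≤ a.1}] L := by
    refine (hB.meas _).inter (bits_mono ?_ _ hG)
    intro a ha
    simp only [Set.mem_ofPred_eq] at ha ⊢
    omega
  have h2 : stackMeasure p (L ∩ {σ | ∀ᶠ n in atTop, ret σ (x + d) n = 0} ∩
      {σ | ret σ x d = 0}) ≤ stackMeasure p (L ∩ {σ | ∀ᶠ n in atTop, ret σ x n = 0}) := by
    refine measure_mono ?_
    rintro σ ⟨⟨hσ1, hσ2⟩, hσ3⟩
    refine ⟨hσ1, ?_⟩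
    simp only [Set.mem_ofPred_eq] at hσ2 hσ3 ⊢
    obtain ⟨N, hN⟩ := eventually_atTop.1 hσ2
    refine eventually_atTop.2 ⟨d + N, fun n hn => ?_⟩
    obtain ⟨m, rfl⟩ := Nat.exists_eq_add_of_le hn
    rw [add_assoc, ret_add _ _ _ _ (hN _ (by omega)), hσ3]
  refine le_trans ?_ h2
  rw [measure_inter_bits p (S := {a | x + d + 1 ≤ a.1}) (T := {a | a.1 ≤ x + d})
    (by
      rw [Set.disjoint_left]; intro a h1 h2
      simp only [Set.mem_ofPred_eq] at h1 h2; omega)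
    (hLm.inter (measurableSet_escape (x + d))) (measurableSet_ret (fun z _ hz _ => hz) 0),
    h.measure_ret_zero, mul_right_comm]
  refine mul_le_mul' h1 (ENNReal.ofReal_le_ofReal ?_)
  rw [show x + d + 1 - 1 - x = d by omega]
  exact one_div_le_one_div_of_le (by linarith [h.one_le_Dfin x d])
    (h.Dfin_le (fun k hk => hρ k (by omega)) d)

/-- Double counting of pairs: `y` the last site of `B`, and `x` never returned to. Summing over `x`
first gives at least `c` times a logarithm for each `y`; summing over `y` first gives at most `1 /
D(x)`, as the last-site events are disjoint. -/
theorem Splitting.measure_biUnion_le (h : Admissible p q) {B : ℕ → Set Stacks} {c : ℝ≥0∞} {K : ℕ}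
    (hB : Splitting p B c K) (hρ : ∀ k, K < k → rho p q k ≤ 1) {l m M : ℕ} (hl : K ≤ l)
    (hlm : l ≤ m) :
    c * ENNReal.ofReal (Real.log ((m - l : ℕ) + 1)) *
      stackMeasure p (⋃ y ∈ Finset.Ioc m M, B y) ≤ ∑ x ∈ Finset.Ico l M, (D p q x)⁻¹ := by
  have hBm : ∀ y, MeasurableSet (B y) := fun y => (hB.meas y).of_bits
  have hLm : ∀ y, MeasurableSet (lastEvent B M y) := fun y =>
    (hBm y).inter (MeasurableSet.iInter fun z => MeasurableSet.iInter fun _ =>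
      MeasurableSet.iInter fun _ => (hBm z).compl)
  set Z : ℕ → Set Stacks := fun x => {σ | ∀ᶠ n in atTop, ret σ x n = 0} with hZ
  have hZm : ∀ x, MeasurableSet (Z x) := fun x => (measurableSet_escape x).of_bits
  have h1 : stackMeasure p (⋃ y ∈ Finset.Ioc m M, B y) ≤
      ∑ y ∈ Finset.Ioc m M, stackMeasure p (lastEvent B M y) := by
    refine le_trans (measure_mono ?_) (measure_biUnion_finset_le _ _)
    intro σ hσ
    simp only [Set.mem_iUnion] at hσ ⊢
    obtain ⟨y₀, hy₀, hσ₀⟩ := hσ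
    classical
    set T := (Finset.Ioc m M).filter fun y => σ ∈ B y with hT
    have hne : T.Nonempty := ⟨y₀, by simp only [hT, Finset.mem_filter]; exact ⟨hy₀, hσ₀⟩⟩
    have hmax := Finset.mem_filter.1 (T.max'_mem hne)
    have hm := (Finset.mem_Ioc.1 hmax.1).1
    refine ⟨T.max' hne, hmax.1, hmax.2, ?_⟩
    simp only [Set.mem_iInter, Set.mem_compl_iff]
    intro z hz hzM hzB
    have : z ∈ T := Finset.mem_filter.2 ⟨Finset.mem_Ioc.2 ⟨by omega, hzM⟩, hzB⟩
    have := T.le_max' z this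
    omega
  have h2 : ∀ y ∈ Finset.Ioc m M,
      c * ENNReal.ofReal (Real.log ((m - l : ℕ) + 1)) * stackMeasure p (lastEvent B M y) ≤
        ∑ x ∈ Finset.Ico l M, stackMeasure p (lastEvent B M y ∩ Z x) := by
    intro y hy
    have hy := Finset.mem_Ioc.1 hy
    have hlog : ENNReal.ofReal (Real.log ((m - l : ℕ) + 1)) ≤
        ∑ x ∈ Finset.Ico l y, ENNReal.ofReal (1 / ((y - 1 - x : ℕ) + 1)) := by
      rw [← ENNReal.ofReal_sum_of_nonneg (fun x _ => by positivity)]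
      refine ENNReal.ofReal_le_ofReal (le_trans ?_ (log_le_sum_Ico l y))
      refine Real.log_le_log (by positivity) ?_
      have : m - l ≤ y - l := by omega
      have : ((m - l : ℕ) : ℝ) ≤ (y - l : ℕ) := by exact_mod_cast this
      linarith
    calc _ ≤ c * (∑ x ∈ Finset.Ico l y, ENNReal.ofReal (1 / ((y - 1 - x : ℕ) + 1))) *
          stackMeasure p (lastEvent B M y) := by gcongr
      _ = ∑ x ∈ Finset.Ico l y, c * ENNReal.ofReal (1 / ((y - 1 - x : ℕ) + 1)) *
          stackMeasure p (lastEvent B M y) := by rw [Finset.mul_sum, Finset.sum_mul]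
      _ ≤ ∑ x ∈ Finset.Ico l y, stackMeasure p (lastEvent B M y ∩ Z x) :=
          Finset.sum_le_sum fun x hx => hB.lastEvent_inter h hρ
            (hl.trans (Finset.mem_Ico.1 hx).1) (Finset.mem_Ico.1 hx).2
      _ ≤ _ := Finset.sum_le_sum_of_subset (Finset.Ico_subset_Ico le_rfl hy.2)
  calc _ ≤ c * ENNReal.ofReal (Real.log ((m - l : ℕ) + 1)) *
        ∑ y ∈ Finset.Ioc m M, stackMeasure p (lastEvent B M y) := by gcongr
    _ = ∑ y ∈ Finset.Ioc m M, c * ENNReal.ofReal (Real.log ((m - l : ℕ) + 1)) *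
        stackMeasure p (lastEvent B M y) := Finset.mul_sum _ _ _
    _ ≤ ∑ y ∈ Finset.Ioc m M, ∑ x ∈ Finset.Ico l M, stackMeasure p (lastEvent B M y ∩ Z x) :=
        Finset.sum_le_sum h2
    _ = ∑ x ∈ Finset.Ico l M, ∑ y ∈ Finset.Ioc m M, stackMeasure p (lastEvent B M y ∩ Z x) :=
        Finset.sum_comm
    _ ≤ ∑ x ∈ Finset.Ico l M, (D p q x)⁻¹ := by
        refine Finset.sum_le_sum fun x _ => ?_
        rw [← h.measure_eventually_ret_zero x, ← measure_biUnion_finset]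
        · refine measure_mono ?_
          simp only [Set.iUnion_subset_iff]
          exact fun _ _ => Set.inter_subset_right
        · have key : ∀ y y' : ℕ, y < y' → y' ∈ Finset.Ioc m M →
              Disjoint (lastEvent B M y ∩ Z x) (lastEvent B M y' ∩ Z x) := by
            intro y y' hlt hy'
            rw [Set.disjoint_left]
            rintro σ ⟨⟨_, hσ⟩, _⟩ ⟨⟨hσ', _⟩, _⟩
            simp only [Set.mem_iInter, Set.mem_compl_iff] at hσ
            exact hσ y' hlt (Finset.mem_Ioc.1 hy').2 hσ'
          intro y hy y' hy' hne
          rcases lt_or_gt_of_ne hne with hlt | hgt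
          · exact key y y' hlt hy'
          · exact (key y' y hgt hy).symm
        · exact fun y _ => (hLm y).inter (hZm x)

/-- The previous bound with `l`, `m`, `M` three successive powers of two, so that `log (m - l + 1)`
is comparable to `log x` for all `x` involved; then Borel-Cantelli over dyadic blocks. -/
theorem Splitting.ae_finite (h : Admissible p q) {B : ℕ → Set Stacks} {c : ℝ≥0∞} {K : ℕ}
    (hc : c ≠ 0) (hB : Splitting p B c K) (hρ : ∀ k, K < k → rho p q k ≤ 1)
    (hsum : criterionSum p q < ∞) : ∀ᵐ σ ∂stackMeasure p, {y | σ ∈ B y}.Finite := by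
  set f : ℕ → ℝ≥0∞ := fun x => (D p q x * ENNReal.ofReal (Real.log x))⁻¹ with hf
  have hdy : ∀ b n, 1 ≤ b →
      ∑ i ∈ Finset.range n, ∑ x ∈ Finset.Ico (2 ^ (b + i)) (2 ^ (b + i + 1)), f x ≤
        criterionSum p q := by
    intro b n hb
    have h1 : ∑ i ∈ Finset.range n, ∑ x ∈ Finset.Ico (2 ^ (b + i)) (2 ^ (b + i + 1)), f x =
        ∑ x ∈ Finset.Ico (2 ^ b) (2 ^ (b + n)), f x := by
      induction n with
      | zero => simp
      | succ n ih =>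
        rw [Finset.sum_range_succ, ih, Finset.sum_Ico_consecutive, add_assoc]
        · exact Nat.pow_le_pow_right (by norm_num) (by omega)
        · exact Nat.pow_le_pow_right (by norm_num) (by omega)
    have h2 : 2 ≤ 2 ^ b := by
      calc 2 = 2 ^ 1 := rfl
        _ ≤ _ := Nat.pow_le_pow_right (by norm_num) hb
    rw [h1]
    calc ∑ x ∈ Finset.Ico (2 ^ b) (2 ^ (b + n)), f x
        ≤ ∑ x ∈ Finset.Ico 2 (2 ^ (b + n)), f x :=
          Finset.sum_le_sum_of_subset (Finset.Ico_subset_Ico h2 le_rfl)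
      _ = ∑ n ∈ Finset.range (2 ^ (b + n) - 2), f (n + 2) := by
          rw [Finset.sum_Ico_eq_sum_range]; simp_rw [add_comm 2]
      _ ≤ criterionSum p q := ENNReal.sum_le_tsum _
  set Y : ℕ → Set Stacks := fun i =>
    ⋃ y ∈ Finset.Ioc (2 ^ (K + i + 2)) (2 ^ (K + i + 3)), B y with hY
  have hbound : ∀ i, c * stackMeasure p (Y i) ≤
      3 * ∑ x ∈ Finset.Ico (2 ^ (K + i + 1)) (2 ^ (K + i + 3)), f x := by
    intro i
    have hKl : K ≤ 2 ^ (K + i + 1) :=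
      (Nat.lt_two_pow_self (n := K)).le.trans (Nat.pow_le_pow_right (by norm_num) (by omega))
    have h1 := hB.measure_biUnion_le h hρ (M := 2 ^ (K + i + 3)) hKl
      (show 2 ^ (K + i + 1) ≤ 2 ^ (K + i + 2) from Nat.pow_le_pow_right (by norm_num) (by omega))
    set H : ℝ := Real.log ((2 ^ (K + i + 2) - 2 ^ (K + i + 1) : ℕ) + 1) with hH
    have hHle : ∀ x : ℕ, x ∈ Finset.Ico (2 ^ (K + i + 1)) (2 ^ (K + i + 3)) → Real.log x ≤ 3 * H := by
      intro x hx
      have hx := Finset.mem_Ico.1 hx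
      have e1 : 2 ^ (K + i + 2) - 2 ^ (K + i + 1) = 2 ^ (K + i + 1) := by
        rw [pow_succ 2 (K + i + 1)]; omega
      have e2 : ((K + i + 1 : ℕ) : ℝ) * Real.log 2 ≤ H := by
        rw [← Real.log_pow, hH, e1]
        refine Real.log_le_log (by positivity) ?_
        push_cast; linarith
      have e3 : Real.log x ≤ ((K + i + 3 : ℕ) : ℝ) * Real.log 2 := by
        rw [← Real.log_pow]
        refine Real.log_le_log ?_ ?_
        · have : 0 < x := lt_of_lt_of_le (by positivity) hx.1
          exact_mod_cast this
        · exact_mod_cast hx.2.le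
      have e4 : ((K + i + 3 : ℕ) : ℝ) ≤ 3 * ((K + i + 1 : ℕ) : ℝ) := by
        push_cast; nlinarith [Nat.cast_nonneg (α := ℝ) K, Nat.cast_nonneg (α := ℝ) i]
      have := Real.log_pos one_lt_two
      nlinarith
    have hH0 : 0 < H := by
      refine Real.log_pos ?_
      have : 2 ^ (K + i + 1) < 2 ^ (K + i + 2) := Nat.pow_lt_pow_right (by norm_num) (by omega)
      have : 0 < 2 ^ (K + i + 2) - 2 ^ (K + i + 1) := by omega
      have : (0 : ℝ) < (2 ^ (K + i + 2) - 2 ^ (K + i + 1) : ℕ) := by exact_mod_cast this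
      linarith
    have hHne : ENNReal.ofReal H ≠ 0 := by simpa using hH0
    have h2 : c * stackMeasure p (Y i) ≤
        (∑ x ∈ Finset.Ico (2 ^ (K + i + 1)) (2 ^ (K + i + 3)), (D p q x)⁻¹) *
          (ENNReal.ofReal H)⁻¹ := by
      rw [← div_eq_mul_inv, ENNReal.le_div_iff_mul_le (Or.inl hHne)
        (Or.inl ENNReal.ofReal_ne_top), mul_right_comm]
      exact h1
    refine h2.trans ?_
    rw [Finset.sum_mul, Finset.mul_sum]
    refine Finset.sum_le_sum fun x hx => ?_
    have hx1 : 1 < x := by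
      have := (Finset.mem_Ico.1 hx).1
      have h3 : 2 ^ 1 ≤ 2 ^ (K + i + 1) := Nat.pow_le_pow_right (by norm_num) (by omega)
      omega
    have hlog : 0 < Real.log x := Real.log_pos (by exact_mod_cast hx1)
    rw [hf]
    simp only
    rw [ENNReal.mul_inv (Or.inr ENNReal.ofReal_ne_top) (Or.inr (by simpa using hlog)),
      mul_left_comm]
    gcongr
    rw [← ENNReal.ofReal_inv_of_pos hH0, ← ENNReal.ofReal_inv_of_pos hlog,
      show (3 : ℝ≥0∞) = ENNReal.ofReal 3 by norm_num, ← ENNReal.ofReal_mul (by norm_num)]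
    refine ENNReal.ofReal_le_ofReal ?_
    rw [inv_le_iff_one_le_mul₀ hH0, ← div_eq_mul_inv, div_mul_eq_mul_div, one_le_div hlog]
    exact hHle x hx
  -- Each summation window is two dyadic blocks long and consecutive windows overlap, so the
  -- criterion series is used twice.
  have htot : c * ∑' i, stackMeasure p (Y i) ≤ 3 * (criterionSum p q + criterionSum p q) := by
    rw [← ENNReal.tsum_mul_left]
    refine ENNReal.tsum_le_of_sum_range_le fun n => ?_
    refine (Finset.sum_le_sum fun i _ => hbound i).trans ?_
    rw [← Finset.mul_sum]
    gcongr
    have : ∀ i, ∑ x ∈ Finset.Ico (2 ^ (K + i + 1)) (2 ^ (K + i + 3)), f x =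
        ∑ x ∈ Finset.Ico (2 ^ (K + 1 + i)) (2 ^ (K + 1 + i + 1)), f x +
          ∑ x ∈ Finset.Ico (2 ^ (K + 2 + i)) (2 ^ (K + 2 + i + 1)), f x := by
      intro i
      rw [show K + i + 1 = K + 1 + i by omega, show K + 2 + i = K + 1 + i + 1 by omega,
        show K + i + 3 = K + 1 + i + 1 + 1 by omega, Finset.sum_Ico_consecutive]
      · exact Nat.pow_le_pow_right (by norm_num) (by omega)
      · exact Nat.pow_le_pow_right (by norm_num) (by omega)
    simp_rw [this, Finset.sum_add_distrib]
    exact add_le_add (hdy _ _ (by omega)) (hdy _ _ (by omega))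
  have hne : ∑' i, stackMeasure p (Y i) ≠ ∞ := by
    intro htop
    rw [htop, ENNReal.mul_top hc, top_le_iff] at htot
    exact (ENNReal.mul_lt_top (by simp) (ENNReal.add_lt_top.2 ⟨hsum, hsum⟩)).ne htot
  filter_upwards [ae_eventually_notMem hne] with σ hσ
  obtain ⟨i₀, hi₀⟩ := eventually_atTop.1 hσ
  refine (Set.finite_Iic (2 ^ (K + i₀ + 2))).subset fun y hy => ?_
  by_contra hlt
  simp only [Set.mem_Iic, not_le] at hlt
  set j := Nat.log 2 (y - 1) with hj
  have hy1 : 2 ^ (K + i₀ + 2) ≤ y - 1 := by omega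
  have hjl : K + i₀ + 2 ≤ j := Nat.le_log_of_pow_le (by norm_num) hy1
  have h3 : 2 ^ j ≤ y - 1 := Nat.pow_log_le_self 2 (by
    have : 0 < 2 ^ (K + i₀ + 2) := by positivity
    omega)
  have h4 : y - 1 < 2 ^ (j + 1) := Nat.lt_pow_succ_log_self (by norm_num) _
  refine hi₀ (j - K - 2) (by omega) ?_
  rw [hY]
  simp only [Set.mem_iUnion]
  refine ⟨y, ?_, hy⟩
  rw [Finset.mem_Ioc, show K + (j - K - 2) + 2 = j by omega,
    show K + (j - K - 2) + 3 = j + 1 by omega]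
  omega

/-! ### The splitting property for upcrossing times and weak cutpoints. -/

theorem disjoint_above (y : ℕ) :
    Disjoint {a : ℕ × ℕ | y + 1 < a.1} {a : ℕ × ℕ | a.1 = y + 1} := by
  rw [Set.disjoint_left]
  intro a h1 h2
  simp only [Set.mem_ofPred_eq] at h1 h2
  omega

theorem eventually_ret_of_pattern {σ : Stacks} {y v j : ℕ}
    (h : ∀ᶠ n in atTop, ret σ (y + 1) n = v) (hp : Pattern σ (y + 1) j (v + 1)) :
    ∀ᶠ n in atTop, ret σ y n = j := by
  have := eventually_ret_step h
  rwa [hp.fails_eq] at this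

/-- When `ret` is eventually `v` at `y + 1`, a stack at `y + 1` starting with `v + 1` ups prevents
any step down to `y`. -/
theorem Admissible.splitting_ret (h : Admissible p q) {K : ℕ}
    (hp : ∀ k, K < k → 1 / 2 ≤ p k) (v : ℕ) :
    Splitting p (fun y => {σ | ∀ᶠ n in atTop, ret σ y n = v})
      (ENNReal.ofReal ((1 / 2) ^ (v + 1))) K where
  meas y := measurableSet_eventually_ret (fun z hz i => (show y ≤ z from hz.le)) v
  split y hy G hG := by
    have hA : MeasurableSet[bits {a | y + 1 < a.1}]
        ({σ | ∀ᶠ n in atTop, ret σ (y + 1) n = v} ∩ G) :=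
      (measurableSet_eventually_ret (fun z hz i => hz) v).inter hG
    have h1 := measure_inter_bits p (disjoint_above y) hA
      (measurableSet_pattern (x := y + 1) (j := 0) (u := v + 1) fun i _ => rfl)
    rw [h.measure_pattern] at h1
    refine le_trans ?_ (le_of_eq_of_le h1.symm (measure_mono ?_))
    · rw [mul_comm]
      gcongr
      rw [pow_zero, one_mul]
      exact pow_le_pow_left₀ (by norm_num) (hp _ (by omega)) _
    · rintro σ ⟨⟨h1, h2⟩, h3⟩
      exact ⟨⟨h1, h2⟩, eventually_ret_of_pattern h1 h3⟩

/-- Event on stacks that occurs when `y` is a weak cutpoint. -/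
def weakEvent (y : ℕ) : Set Stacks :=
  {σ | ∃ v j, (∀ᶠ n in atTop, ret σ y n = v) ∧ Pattern σ y j (v + 1)}

/-- Given the value `v` at `y + 1`, the admissible patterns there have probabilities `q ^ j * p ^ (v
+ 1)`, with sum `p ^ v`. The pattern `j = 0`, which prevents a step down to `y`, has share `p ≥ 1 /
2`, uniformly in `v`. -/
theorem Admissible.splitting_weak (h : Admissible p q) {K : ℕ}
    (hp : ∀ k, K < k → 1 / 2 ≤ p k) : Splitting p weakEvent (ENNReal.ofReal (1 / 2)) K where
  meas y := by
    have : weakEvent y = ⋃ v, ⋃ j, ({σ | ∀ᶠ n in atTop, ret σ y n = v} ∩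
        {σ | Pattern σ y j (v + 1)}) := by
      ext σ; simp [weakEvent]
    rw [this]
    exact MeasurableSet.iUnion fun v => MeasurableSet.iUnion fun j =>
      (measurableSet_eventually_ret (fun z hz i => (show y ≤ z from hz.le)) v).inter
        (measurableSet_pattern fun i _ => (show y ≤ y from le_rfl))
  split y hy G hG := by
    set μ := stackMeasure p
    set E : ℕ → Set Stacks := fun v => {σ | ∀ᶠ n in atTop, ret σ (y + 1) n = v} ∩ G with hE
    have hA : ∀ v, MeasurableSet[bits {a | y + 1 < a.1}] (E v) := fun v =>
      (measurableSet_eventually_ret (fun z hz i => hz) v).inter hG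
    have hpat : ∀ v j, μ (E v ∩ {σ | Pattern σ (y + 1) j (v + 1)}) =
        μ (E v) * ENNReal.ofReal (q (y + 1) ^ j * p (y + 1) ^ (v + 1)) := by
      intro v j
      rw [← h.measure_pattern]
      exact measure_inter_bits p (disjoint_above y) (hA v)
        (measurableSet_pattern (x := y + 1) (j := j) (u := v + 1) fun i _ => rfl)
    have hp0 := h.p_pos (y + 1)
    have hq0 := h.q_nonneg (y + 1)
    have hq1 : 1 - ENNReal.ofReal (q (y + 1)) = ENNReal.ofReal (p (y + 1)) := by
      rw [← ENNReal.ofReal_one, ← ENNReal.ofReal_sub _ hq0]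
      congr 1
      have := h.add_eq_one (y + 1)
      linarith
    have hup : μ (weakEvent (y + 1) ∩ G) ≤
        ∑' v, ∑' j, μ (E v ∩ {σ | Pattern σ (y + 1) j (v + 1)}) := by
      refine le_trans (measure_mono ?_) ((measure_iUnion_le _).trans
        (ENNReal.tsum_le_tsum fun v => measure_iUnion_le _))
      rintro σ ⟨⟨v, j, h1, h2⟩, hσ⟩
      simp only [Set.mem_iUnion]
      exact ⟨v, j, ⟨h1, hσ⟩, h2⟩
    have hlow : ∑' v, μ (E v ∩ {σ | Pattern σ (y + 1) 0 (v + 1)}) ≤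
        μ (weakEvent (y + 1) ∩ G ∩ {σ | ∀ᶠ n in atTop, ret σ y n = 0}) := by
      rw [← measure_iUnion]
      · refine measure_mono (Set.iUnion_subset fun v => ?_)
        rintro σ ⟨⟨h1, h2⟩, h3⟩
        exact ⟨⟨⟨v, 0, h1, h3⟩, h2⟩, eventually_ret_of_pattern h1 h3⟩
      · intro v v' hne
        rw [Function.onFun, Set.disjoint_left]
        rintro σ ⟨⟨h1, _⟩, _⟩ ⟨⟨h2, _⟩, _⟩
        obtain ⟨n, h3, h4⟩ := (h1.and h2).exists
        exact hne (h3.symm.trans h4)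
      · exact fun v => (hA v).of_bits.inter
          (measurableSet_pattern (S := Set.univ) fun i _ => Set.mem_univ _).of_bits
    refine le_trans ?_ hlow
    refine (mul_le_mul_right hup _).trans ?_
    rw [← ENNReal.tsum_mul_left]
    refine ENNReal.tsum_le_tsum fun v => ?_
    simp_rw [hpat, ENNReal.tsum_mul_left, ENNReal.ofReal_mul (pow_nonneg hq0 _),
      ENNReal.ofReal_pow hq0]
    rw [ENNReal.tsum_mul_right, ENNReal.tsum_geometric, hq1, mul_left_comm, pow_zero, one_mul]
    gcongr
    rw [← mul_assoc]
    refine mul_le_of_le_one_left bot_le ?_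
    rw [← ENNReal.ofReal_inv_of_pos hp0, ← ENNReal.ofReal_mul (by norm_num), ← ENNReal.ofReal_one]
    refine ENNReal.ofReal_le_ofReal ?_
    rw [← div_eq_mul_inv, div_le_one hp0]
    exact hp _ (by omega)

theorem Admissible.half_le_p (h : Admissible p q) {k : ℕ} (hρ : rho p q k ≤ 1) : 1 / 2 ≤ p k := by
  unfold rho at hρ
  rw [div_le_one (h.p_pos k)] at hρ
  have := h.add_eq_one k
  linarith

theorem Admissible.ae_finite_walk (h : Admissible p q) {K : ℕ}
    (hρ : ∀ k, K < k → rho p q k ≤ 1) (hsum : criterionSum p q < ∞) :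
    ∀ᵐ σ ∂stackMeasure p,
      (∀ v : ℕ, {x | upTime (walk σ) x = ((v + 1 : ℕ) : ℕ∞)}.Finite) ∧ (Cw (walk σ)).Finite := by
  have hp : ∀ k, K < k → 1 / 2 ≤ p k := fun k hk => h.half_le_p (hρ k hk)
  have h1 := ae_all_iff.2 fun v => (h.splitting_ret hp v).ae_finite h
    (by rw [Ne, ENNReal.ofReal_eq_zero, not_le]; positivity) hρ hsum
  have h2 := (h.splitting_weak hp).ae_finite h (by norm_num) hρ hsum
  filter_upwards [h.ae_good, h1, h2] with σ hσ h1 h2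
  refine ⟨fun v => (h1 v).subset fun x hx => (driven_walk σ).eventually_ret hσ hx, ?_⟩
  refine (h2.insert 0).subset fun y hy => ?_
  rcases Nat.eq_zero_or_pos y with rfl | hpos
  · exact Set.mem_insert _ _
  · exact Set.mem_insert_of_mem _ ((driven_walk σ).pattern_of_weak hσ hpos hy)

end Convergent

/-! ### Divergent case: an estimate for sums of increments -/

/-- Used with `u`, `v` the square roots of consecutive values of `g` and `L = log x`: the bound on
`s` trades the factor `1 / L` for an increment of the square root. -/
theorem div_sq_sub_le {u v s L : ℝ} (hu : 0 < u) (hvu : v ≤ u) (hL : 0 < L)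
    (hs : s ≤ 2 * u * L) (hs0 : 0 < s) :
    1 / L * ((u ^ 2 - v ^ 2) / u ^ 2) ≤ 4 / s * (u - v) := by
  have h1 : (u ^ 2 - v ^ 2) / u ^ 2 ≤ 2 * (u - v) / u := by
    rw [div_le_div_iff₀ (by positivity) hu]
    nlinarith [mul_nonneg (mul_nonneg (sub_nonneg.2 hvu) (sub_nonneg.2 hvu)) hu.le]
  calc 1 / L * ((u ^ 2 - v ^ 2) / u ^ 2) ≤ 1 / L * (2 * (u - v) / u) := by gcongr
    _ = 4 / (2 * u * L) * (u - v) := by field_simp; ring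
    _ ≤ 4 / s * (u - v) := by
        have := sub_nonneg.2 hvu
        gcongr

theorem div_le_log_sub_log {a b : ℝ} (hb : 0 < b) (hba : b ≤ a) :
    (a - b) / a ≤ Real.log a - Real.log b := by
  have ha : 0 < a := hb.trans_le hba
  have := Real.log_le_sub_one_of_pos (div_pos hb ha)
  rw [Real.log_div hb.ne' ha.ne'] at this
  rw [sub_div, div_self ha.ne']
  linarith

section Sums

variable {P R : ℕ → ℝ} {K : ℕ}

theorem sum_Ico_of_sub_eq (hdiff : ∀ x, K ≤ x → R x - R (x + 1) = P x) {x y : ℕ} (hx : K ≤ x)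
    (hxy : x ≤ y) : ∑ i ∈ Finset.Ico x y, P i = R x - R y := by
  induction y, hxy using Nat.le_induction with
  | base => simp
  | succ y hy ih =>
    rw [Finset.sum_Ico_succ_top hy, ih, ← hdiff y (by omega)]
    ring

/-- In the application `P x` is the product of the `ρ` up to `x` and `R x = P x * D(x)`, so `P x / R
x = 1 / D(x)` and `P x / (R x - R y) = 1 / D(x, y)`. Where `R x ≥ κ * R y` the two differ by a
factor at most `κ / (κ - 1)`. The remaining terms are increments of `R` divided by `R x - R y` and
`log x`; telescoping square roots (`2 * x ≤ y`) and logarithms (`2 * x > y`) bound their sum. -/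
theorem sum_div_sub_le {c : ℕ → ℝ} {δ κ : ℝ} (hK : 3 ≤ K) (hκ : 1 < κ) (hδ : 0 < δ)
    (hP : ∀ x, K ≤ x → 0 < P x) (hanti : ∀ x y, K ≤ x → x ≤ y → P y ≤ P x)
    (hR : ∀ x, K ≤ x → 0 < R x) (hdiff : ∀ x, K ≤ x → R x - R (x + 1) = P x)
    (hD : ∀ x : ℕ, K ≤ x → R x ≤ δ * x * Real.log x * P x)
    (hc0 : ∀ x, 0 ≤ c x) (hc1 : ∀ x, c x ≤ 1) :
    ∃ C, 0 ≤ C ∧ ∀ y, K ≤ y → ∑ x ∈ Finset.Ico K y, c x / Real.log x * (P x / (R x - R y)) ≤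
      C + κ / (κ - 1) * ∑ x ∈ Finset.Ico K y, c x / Real.log x * (P x / R x) := by
  have hRanti : ∀ x y, K ≤ x → x ≤ y → R y ≤ R x := by
    intro x y hx hxy
    have := sum_Ico_of_sub_eq hdiff hx hxy
    have h2 : 0 ≤ ∑ i ∈ Finset.Ico x y, P i :=
      Finset.sum_nonneg fun i hi => (hP i (hx.trans (Finset.mem_Ico.1 hi).1)).le
    linarith
  have hlog1 : ∀ x : ℕ, K ≤ x → 1 ≤ Real.log x := by
    intro x hx
    rw [Real.le_log_iff_exp_le (by have : 0 < x := by omega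
                                   exact_mod_cast this)]
    have : (3 : ℝ) ≤ x := by exact_mod_cast hK.trans hx
    linarith [Real.exp_one_lt_d9]
  have hκ1 : 0 < κ - 1 := by linarith
  refine ⟨4 * Real.sqrt δ * Real.sqrt κ + 2 * (Real.log (κ * (1 + δ)) + 2) + 1,
    by have : 0 ≤ Real.log (κ * (1 + δ)) := Real.log_nonneg (by nlinarith)
       positivity, fun y hy => ?_⟩
  have hLκ : 0 ≤ Real.log (κ * (1 + δ)) := Real.log_nonneg (by nlinarith)
  rcases hy.eq_or_lt with rfl | hlt
  · simp only [Finset.Ico_self, Finset.sum_empty, mul_zero, add_zero]; positivity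
  obtain ⟨z, rfl⟩ : ∃ z, y = z + 1 := ⟨y - 1, by omega⟩
  have hz : K ≤ z := by omega
  set Y := R (z + 1) with hY
  have hY0 : 0 < Y := hR _ hy
  have hyL : 1 ≤ Real.log (z + 1 : ℕ) := hlog1 _ hy
  have hs0 : 0 < Real.sqrt Y := Real.sqrt_pos.2 hY0
  -- The truncation lets the telescoping sums run over all `x`: `g` never increases, and its
  -- decrement at `x` equals `P x` wherever `R x < κ * Y`.
  set g : ℕ → ℝ := fun x => min (R x - Y) (κ * Y) with hg
  have hr0 : ∀ x, K ≤ x → x ≤ z → 0 < R x - Y := by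
    intro x hx hxz
    have h1 := hRanti x z hx hxz
    have h2 := hdiff z hz
    have h3 := hP z hz
    linarith
  have hg0 : ∀ x, K ≤ x → x ≤ z → 0 < g x := fun x hx hxz =>
    lt_min (hr0 x hx hxz) (by positivity)
  have hganti : ∀ x, K ≤ x → g (x + 1) ≤ g x := fun x hx =>
    min_le_min_right _ (by linarith [hRanti x (x + 1) hx (by omega)])
  -- pointwise estimate
  have hterm : ∀ x ∈ Finset.Ico K z, c x / Real.log x * (P x / (R x - Y)) ≤
      κ / (κ - 1) * (c x / Real.log x * (P x / R x)) +
        (4 * Real.sqrt δ / Real.sqrt Y * (Real.sqrt (g x) - Real.sqrt (g (x + 1))) +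
          2 / Real.log (z + 1 : ℕ) * (Real.log (g x) - Real.log (g (x + 1)))) := by
    intro x hx
    obtain ⟨hx, hxz⟩ := Finset.mem_Ico.1 hx
    have hPx := hP x hx
    have hLx := hlog1 x hx
    have hr := hr0 x hx hxz.le
    have hRx := hR x hx
    have n1 : 0 ≤ κ / (κ - 1) * (c x / Real.log x * (P x / R x)) := by
      have := hc0 x; positivity
    have n2 : 0 ≤ 4 * Real.sqrt δ / Real.sqrt Y * (Real.sqrt (g x) - Real.sqrt (g (x + 1))) :=
      mul_nonneg (by positivity) (sub_nonneg.2 (Real.sqrt_le_sqrt (hganti x hx)))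
    have n3 : 0 ≤ 2 / Real.log (z + 1 : ℕ) * (Real.log (g x) - Real.log (g (x + 1))) :=
      mul_nonneg (by positivity)
        (sub_nonneg.2 (Real.log_le_log (hg0 _ (by omega) (by omega)) (hganti x hx)))
    rcases le_or_gt (κ * Y) (R x) with hbig | hsmall
    · have : P x / (R x - Y) ≤ κ / (κ - 1) * (P x / R x) := by
        rw [div_mul_div_comm, div_le_div_iff₀ hr (by positivity)]
        have : (κ - 1) * R x ≤ κ * (R x - Y) := by linarith
        nlinarith [mul_le_mul_of_nonneg_left this hPx.le]
      have h2 : c x / Real.log x * (P x / (R x - Y)) ≤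
          c x / Real.log x * (κ / (κ - 1) * (P x / R x)) :=
        mul_le_mul_of_nonneg_left this (div_nonneg (hc0 x) (by linarith))
      have h3 : c x / Real.log x * (κ / (κ - 1) * (P x / R x)) =
        κ / (κ - 1) * (c x / Real.log x * (P x / R x)) := by ring
      linarith
    · have hgx : g x = R x - Y := min_eq_left (by linarith)
      have hgx1 : g (x + 1) = R (x + 1) - Y :=
        min_eq_left (by linarith [hRanti x (x + 1) hx (by omega)])
      have hPx' : P x = g x - g (x + 1) := by rw [hgx, hgx1, ← hdiff x hx]; ring
      have hgpos := hg0 x hx hxz.le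
      have hgpos1 := hg0 (x + 1) (by omega) hxz
      have hw : c x / Real.log x * (P x / (R x - Y)) ≤ 1 / Real.log x * (P x / (R x - Y)) := by
        have := hc1 x; gcongr
      refine hw.trans ?_
      rw [hPx'] at n1
      rw [← hgx, hPx']
      -- In the first case `g x ≥ x * P (2 * x)`, and the bound on `R (2 * x)` yields `Y ≤ 4 * δ *
      -- log x * g x`, so `1 / log x` is at most a multiple of `√(g x / Y)`. In the second, `log x ≥
      -- log (z + 1) / 2` and the weight is essentially constant.
      rcases le_or_gt (2 * x) (z + 1) with h2x | h2x
      · have hxr : (x : ℝ) * P (2 * x) ≤ g x := by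
          have h1 := sum_Ico_of_sub_eq hdiff hx (show x ≤ 2 * x by omega)
          have h2 : ∑ i ∈ Finset.Ico x (2 * x), P (2 * x) ≤ ∑ i ∈ Finset.Ico x (2 * x), P i :=
            Finset.sum_le_sum fun i hi => hanti i (2 * x)
              (hx.trans (Finset.mem_Ico.1 hi).1) (Finset.mem_Ico.1 hi).2.le
          rw [Finset.sum_const, Nat.card_Ico, show 2 * x - x = x by omega, nsmul_eq_mul] at h2
          have h3 := hRanti (2 * x) (z + 1) (by omega) h2x
          rw [hgx]; linarith
        have hx0 : (0 : ℝ) < x := by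
          have : 0 < x := by omega
          exact_mod_cast this
        have hlog2 : Real.log (2 * x : ℕ) ≤ 2 * Real.log x := by
          push_cast
          rw [Real.log_mul (by norm_num) hx0.ne']
          have : Real.log 2 ≤ Real.log x := Real.log_le_log (by norm_num) (by
            have : 2 ≤ x := by omega
            exact_mod_cast this)
          linarith
        have hYg : Y ≤ 4 * δ * Real.log x * g x := by
          have h3 := hRanti (2 * x) (z + 1) (by omega) h2x
          have h4 := hD (2 * x) (by omega)
          have hP2 := hP (2 * x) (by omega)
          calc Y ≤ δ * (2 * x : ℕ) * Real.log (2 * x : ℕ) * P (2 * x) := h3.trans h4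
            _ ≤ δ * (2 * x : ℕ) * (2 * Real.log x) * P (2 * x) := by gcongr
            _ = 4 * δ * Real.log x * (x * P (2 * x)) := by push_cast; ring
            _ ≤ _ := by gcongr
        have hs : Real.sqrt Y / Real.sqrt δ ≤ 2 * Real.sqrt (g x) * Real.log x := by
          rw [div_le_iff₀ (Real.sqrt_pos.2 hδ)]
          refine Real.sqrt_le_iff.2 ⟨by positivity, hYg.trans ?_⟩
          have : (2 * Real.sqrt (g x) * Real.log x * Real.sqrt δ) ^ 2 =
              4 * g x * Real.log x ^ 2 * δ := by
            rw [mul_pow, mul_pow, mul_pow, Real.sq_sqrt hgpos.le, Real.sq_sqrt hδ.le]; ring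
          rw [this]
          have : Real.log x ≤ Real.log x ^ 2 := by nlinarith
          calc 4 * δ * Real.log x * g x ≤ 4 * δ * Real.log x ^ 2 * g x := by gcongr
            _ = _ := by ring
        have := div_sq_sub_le (Real.sqrt_pos.2 hgpos)
          (Real.sqrt_le_sqrt (hganti x hx)) (by linarith) hs
          (div_pos hs0 (Real.sqrt_pos.2 hδ))
        rw [Real.sq_sqrt hgpos.le, Real.sq_sqrt hgpos1.le, div_div_eq_mul_div] at this
        linarith
      · have h1 := div_le_log_sub_log hgpos1 (hganti x hx)
        have h0 : 0 ≤ (g x - g (x + 1)) / g x := div_nonneg (by rw [← hPx']; exact hPx.le) hgpos.le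
        have hlogy : Real.log (z + 1 : ℕ) ≤ 2 * Real.log x := by
          rw [← Real.log_rpow (by have : 0 < x := by omega
                                  exact_mod_cast this)]
          refine Real.log_le_log (by positivity) ?_
          rw [Real.rpow_two]
          have : z + 1 ≤ x ^ 2 := by nlinarith
          exact_mod_cast this
        have h2 : 1 / Real.log x ≤ 2 / Real.log (z + 1 : ℕ) := by
          rw [div_le_div_iff₀ (by linarith) (by linarith)]; linarith
        have : 1 / Real.log x * ((g x - g (x + 1)) / g x) ≤
            2 / Real.log (z + 1 : ℕ) * (Real.log (g x) - Real.log (g (x + 1))) :=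
          mul_le_mul h2 h1 h0 (by positivity)
        linarith
  have htel : ∀ f : ℕ → ℝ, ∑ x ∈ Finset.Ico K z, (f x - f (x + 1)) = f K - f z := by
    intro f
    have := Finset.sum_Ico_sub f hz
    rw [← neg_inj, ← Finset.sum_neg_distrib, neg_sub, ← this]
    exact Finset.sum_congr rfl fun x _ => by ring
  have hsum := Finset.sum_le_sum hterm
  rw [Finset.sum_add_distrib, Finset.sum_add_distrib, ← Finset.mul_sum, ← Finset.mul_sum,
    ← Finset.mul_sum, htel fun x => Real.sqrt (g x), htel fun x => Real.log (g x)] at hsum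
  have hsq : 4 * Real.sqrt δ / Real.sqrt Y * (Real.sqrt (g K) - Real.sqrt (g z)) ≤
      4 * Real.sqrt δ * Real.sqrt κ := by
    have h1 : Real.sqrt (g K) ≤ Real.sqrt κ * Real.sqrt Y := by
      rw [← Real.sqrt_mul (by linarith)]
      exact Real.sqrt_le_sqrt (min_le_right _ _)
    have h2 : Real.sqrt (g K) - Real.sqrt (g z) ≤ Real.sqrt κ * Real.sqrt Y := by
      linarith [Real.sqrt_nonneg (g z)]
    calc _ ≤ 4 * Real.sqrt δ / Real.sqrt Y * (Real.sqrt κ * Real.sqrt Y) := by gcongr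
      _ = _ := by field_simp
  have hlg : 2 / Real.log (z + 1 : ℕ) * (Real.log (g K) - Real.log (g z)) ≤
      2 * (Real.log (κ * (1 + δ)) + 2) := by
    have hz0 : (1 : ℝ) ≤ (z + 1 : ℕ) := by push_cast; linarith [Nat.cast_nonneg (α := ℝ) z]
    have hlz : Real.log (z + 1 : ℕ) ≤ (z + 1 : ℕ) :=
      (Real.log_le_sub_one_of_pos (by linarith)).trans (by linarith)
    -- `g` starts no higher than `κ * Y` and ends no lower than that divided by a quadratic in `z`,
    -- so `log g` drops by `O(log z)`.
    have h1 : κ * Y ≤ κ * (1 + δ) * (z + 1 : ℕ) ^ 2 * g z := by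
      have hPz : 0 < P (z + 1) := hP _ hy
      have hrz : P (z + 1) ≤ R z - Y := by rw [hdiff z hz]; exact hanti z (z + 1) hz (by omega)
      rcases le_total (R z - Y) (κ * Y) with hle | hle
      · have hgz : g z = R z - Y := min_eq_left hle
        rw [hgz]
        have h4 := hD (z + 1) hy
        calc κ * Y ≤ κ * (δ * (z + 1 : ℕ) * Real.log (z + 1 : ℕ) * P (z + 1)) := by gcongr
          _ ≤ κ * ((1 + δ) * (z + 1 : ℕ) * (z + 1 : ℕ) * (R z - Y)) := by
              gcongr
              linarith
          _ = _ := by ring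
      · have hgz : g z = κ * Y := min_eq_right hle
        rw [hgz]
        have : 1 ≤ κ * (1 + δ) * (z + 1 : ℕ) ^ 2 := by
          have : (1 : ℝ) ≤ (z + 1 : ℕ) ^ 2 := one_le_pow₀ hz0
          have : 1 ≤ κ * (1 + δ) := by nlinarith
          nlinarith
        have hκY : 0 < κ * Y := by positivity
        nlinarith
    have hgz := hg0 z hz le_rfl
    have h2 : Real.log (g K) ≤
        Real.log (κ * (1 + δ)) + 2 * Real.log (z + 1 : ℕ) + Real.log (g z) := by
      calc Real.log (g K) ≤ Real.log (κ * (1 + δ) * (z + 1 : ℕ) ^ 2 * g z) :=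
            Real.log_le_log (hg0 K le_rfl hz) ((min_le_right _ _).trans h1)
        _ = _ := by
            rw [Real.log_mul (by positivity) hgz.ne', Real.log_mul (by positivity) (by positivity),
              Real.log_pow]
            push_cast; ring
    rw [div_mul_eq_mul_div, div_le_iff₀ (by linarith)]
    nlinarith
  -- The term `x = z` is kept apart since `g (z + 1) = 0`, which spoils the logarithm; there `R z -
  -- Y` is simply `P z`.
  have hlast : c z / Real.log z * (P z / (R z - Y)) ≤ 1 := by
    rw [hY, hdiff z hz, div_self (hP z hz).ne', mul_one, div_le_one (by linarith [hlog1 z hz])]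
    exact (hc1 z).trans (hlog1 z hz)
  rw [Finset.sum_Ico_succ_top hz, Finset.sum_Ico_succ_top hz]
  have hlast2 : 0 ≤ κ / (κ - 1) * (c z / Real.log z * (P z / R z)) := by
    have := hc0 z
    have := hlog1 z hz
    have := hP z hz
    have := hR z hz
    positivity
  rw [mul_add]
  linarith

end Sums

/-! ### A weighted second moment criterion -/

/-- If no event occurs from `m` on, the weighted count stays bounded while its mean `S n` diverges.
Chebyshev bounds the probability of this by `4 * (C / S n + ε)`, and `ε` is arbitrary. -/
theorem ae_infinite_of_second_moment {Ω : Type*} [MeasurableSpace Ω] {μ : Measure Ω}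
    [IsProbabilityMeasure μ] {E : ℕ → Set Ω} (hE : ∀ z, MeasurableSet (E z)) {w : ℕ → ℝ}
    (hw : ∀ z, 0 ≤ w z) {K : ℕ} {S : ℕ → ℝ}
    (hS : ∀ n, S n = ∑ z ∈ Finset.Ico K n, w z * μ.real (E z)) (hlim : Tendsto S atTop atTop)
    (hsq : ∀ ε : ℝ, 0 < ε → ∃ C : ℝ, ∀ n, ∑ x ∈ Finset.Ico K n, ∑ z ∈ Finset.Ico K n,
      w x * w z * μ.real (E x ∩ E z) ≤ C * S n + (1 + ε) * S n ^ 2) :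
    ∀ᵐ ω ∂μ, {z | ω ∈ E z}.Infinite := by
  suffices h : ∀ m : ℕ, μ {ω | ∀ z, m ≤ z → ω ∉ E z} = 0 by
    have h' := ae_all_iff.2 fun m => measure_eq_zero_iff_ae_notMem.1 (h m)
    filter_upwards [h'] with ω hω
    rw [Set.infinite_iff_exists_gt]
    intro a
    have := hω (a + 1)
    push Not at this
    obtain ⟨z, hz, hz'⟩ := this
    exact ⟨z, hz', by omega⟩
  intro m
  set F := {ω | ∀ z, m ≤ z → ω ∉ E z} with hF
  set N : ℕ → Ω → ℝ := fun n ω => ∑ z ∈ Finset.Ico K n, w z * (E z).indicator 1 ω with hN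
  have hint1 : ∀ A : Set Ω, MeasurableSet A → Integrable (A.indicator (1 : Ω → ℝ)) μ :=
    fun A hA => (integrable_const (1 : ℝ)).indicator hA
  have hi1 : ∀ n, Integrable (N n) μ := fun n =>
    integrable_finsetSum _ fun z _ => (hint1 _ (hE z)).const_mul _
  have hm1 : ∀ n, ∫ ω, N n ω ∂μ = S n := by
    intro n
    rw [hS, integral_finsetSum _ fun z _ => (hint1 _ (hE z)).const_mul _]
    refine Finset.sum_congr rfl fun z _ => ?_
    rw [integral_const_mul, integral_indicator_one (hE z)]
  have hNsq : ∀ n, (fun ω => N n ω ^ 2) = fun ω => ∑ x ∈ Finset.Ico K n, ∑ z ∈ Finset.Ico K n,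
      w x * w z * (E x ∩ E z).indicator 1 ω := by
    intro n
    funext ω
    rw [sq, hN, Finset.sum_mul_sum]
    refine Finset.sum_congr rfl fun x _ => Finset.sum_congr rfl fun z _ => ?_
    rw [Set.inter_indicator_one, Pi.mul_apply]
    ring
  have hi2 : ∀ n, Integrable (fun ω => N n ω ^ 2) μ := by
    intro n
    rw [hNsq]
    exact integrable_finsetSum _ fun x _ => integrable_finsetSum _ fun z _ =>
      (hint1 _ ((hE x).inter (hE z))).const_mul _
  have hm2 : ∀ n, ∫ ω, N n ω ^ 2 ∂μ = ∑ x ∈ Finset.Ico K n, ∑ z ∈ Finset.Ico K n,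
      w x * w z * μ.real (E x ∩ E z) := by
    intro n
    rw [hNsq, integral_finsetSum _ fun x _ => integrable_finsetSum _ fun z _ =>
      (hint1 _ ((hE x).inter (hE z))).const_mul _]
    refine Finset.sum_congr rfl fun x _ => ?_
    rw [integral_finsetSum _ fun z _ => (hint1 _ ((hE x).inter (hE z))).const_mul _]
    refine Finset.sum_congr rfl fun z _ => ?_
    rw [integral_const_mul, integral_indicator_one ((hE x).inter (hE z))]
  set M := ∑ z ∈ Finset.Ico K m, w z with hM
  have hNM : ∀ n, ∀ ω ∈ F, N n ω ≤ M := by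
    intro n ω hω
    have h1 : N n ω = ∑ z ∈ (Finset.Ico K n).filter (· < m), w z * (E z).indicator 1 ω := by
      rw [Finset.sum_filter_of_ne]
      intro z _ hne
      by_contra hge
      exact hne (by rw [Set.indicator_of_notMem (hω z (by omega)), mul_zero])
    rw [h1]
    calc _ ≤ ∑ z ∈ (Finset.Ico K n).filter (· < m), w z := by
          refine Finset.sum_le_sum fun z _ => mul_le_of_le_one_right (hw z) ?_
          exact Set.indicator_apply_le' (fun _ => le_rfl) (fun _ => zero_le_one)
      _ ≤ M := Finset.sum_le_sum_of_subset_of_nonneg (fun z hz => by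
            simp only [Finset.mem_filter, Finset.mem_Ico] at hz ⊢; omega) fun z _ _ => hw z
  have hkey : ∀ ε : ℝ, 0 < ε → μ.real F ≤ 4 * (2 * ε) := by
    intro ε hε
    obtain ⟨C, hC⟩ := hsq ε hε
    obtain ⟨n, hn1, hn2⟩ := ((hlim.eventually_ge_atTop (2 * M + 1)).and
      (hlim.eventually_ge_atTop (C / ε))).exists
    have hM0 : 0 ≤ M := Finset.sum_nonneg fun z _ => hw z
    have hSn : 0 < S n := by linarith
    have hi3 : Integrable (fun ω => (N n ω - S n) ^ 2) μ := by
      have : (fun ω => (N n ω - S n) ^ 2) =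
          fun ω => N n ω ^ 2 - 2 * S n * N n ω + S n ^ 2 := by funext ω; ring
      rw [this]
      exact ((hi2 n).sub ((hi1 n).const_mul _)).add (integrable_const _)
    have hvar : ∫ ω, (N n ω - S n) ^ 2 ∂μ ≤ C * S n + ε * S n ^ 2 := by
      have : (fun ω => (N n ω - S n) ^ 2) =
          fun ω => N n ω ^ 2 - 2 * S n * N n ω + S n ^ 2 := by funext ω; ring
      have hi4 : Integrable (fun ω => N n ω ^ 2 - 2 * S n * N n ω) μ :=
        (hi2 n).sub ((hi1 n).const_mul _)
      rw [this, integral_add hi4 (integrable_const _),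
        integral_sub (hi2 n) ((hi1 n).const_mul _), integral_const_mul, hm1, hm2]
      have := hC n
      simp only [integral_const, probReal_univ, one_smul]
      linarith
    have hmarkov := mul_meas_ge_le_integral_of_nonneg
      (Eventually.of_forall fun ω => sq_nonneg (N n ω - S n)) hi3 (S n ^ 2 / 4)
    have hsub : μ.real F ≤ μ.real {ω | S n ^ 2 / 4 ≤ (N n ω - S n) ^ 2} := by
      refine measureReal_mono fun ω hω => ?_
      have := hNM n ω hω
      simp only [Set.mem_ofPred_eq]
      nlinarith
    have h5 : S n ^ 2 / 4 * μ.real F ≤ C * S n + ε * S n ^ 2 :=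
      (mul_le_mul_of_nonneg_left hsub (by positivity)).trans (hmarkov.trans hvar)
    have h6 : C * S n ≤ ε * S n ^ 2 := by
      rw [div_le_iff₀ hε] at hn2
      nlinarith
    have h7 : S n ^ 2 * μ.real F ≤ S n ^ 2 * (4 * (2 * ε)) := by linarith
    exact le_of_mul_le_mul_left h7 (by positivity)
  have hzero : μ.real F = 0 := by
    refine le_antisymm (le_of_forall_pos_le_add fun ε hε => ?_) measureReal_nonneg
    have := hkey (ε / 8) (by positivity)
    linarith
  exact (measureReal_eq_zero_iff).1 hzero

/-! ### Divergent case: cut events -/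

section CutEvents

variable {p q : ℕ → ℝ}

/-- Prescribed initial instructions in the stacks `z`, `z - 1` and `z - 2`. -/
def patternEvent (i j z : ℕ) : Set Stacks :=
  {σ | Pattern σ z i 1} ∩ ({σ | Pattern σ (z - 1) j (i + 1)} ∩ {σ | Pattern σ (z - 2) 0 (j + 1)})

/-- The walk never returns from `z + 1` to `z`, steps `i + 1` times from `z - 1` to `z` and `j + 1`
times from `z - 2` to `z - 1`, and never returns from `z - 2` to `z - 3`. -/
def cutEvent (i j z : ℕ) : Set Stacks :=
  {σ | ∀ᶠ n in atTop, ret σ z n = 0} ∩ patternEvent i j z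

/-- The probability of `patternEvent i j z`. -/
def patternProb (p q : ℕ → ℝ) (i j z : ℕ) : ℝ :=
  q z ^ i * p z ^ 1 * (q (z - 1) ^ j * p (z - 1) ^ (i + 1) * (q (z - 2) ^ 0 * p (z - 2) ^ (j + 1)))

theorem Admissible.patternProb_nonneg (h : Admissible p q) (i j z : ℕ) :
    0 ≤ patternProb p q i j z := by
  have := h.p_pos z
  have := h.p_pos (z - 1)
  have := h.p_pos (z - 2)
  have := h.q_nonneg z
  have := h.q_nonneg (z - 1)
  unfold patternProb
  positivity

theorem Admissible.patternProb_le_one (h : Admissible p q) (i j z : ℕ) :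
    patternProb p q i j z ≤ 1 := by
  have hp : ∀ x n, p x ^ n ≤ 1 := fun x n => pow_le_one₀ (h.p_pos x).le (h.p_le_one x)
  have hq : ∀ x n, q x ^ n ≤ 1 := fun x n => pow_le_one₀ (h.q_nonneg x) (h.q_lt_one x).le
  have hp' : ∀ x n, 0 ≤ p x ^ n := fun x n => pow_nonneg (h.p_pos x).le n
  have hq' : ∀ x n, 0 ≤ q x ^ n := fun x n => pow_nonneg (h.q_nonneg x) n
  exact mul_le_one₀ (mul_le_one₀ (hq _ _) (hp' _ _) (hp _ _))
    (mul_nonneg (mul_nonneg (hq' _ _) (hp' _ _)) (mul_nonneg (hq' _ _) (hp' _ _)))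
    (mul_le_one₀ (mul_le_one₀ (hq _ _) (hp' _ _) (hp _ _)) (mul_nonneg (hq' _ _) (hp' _ _))
      (mul_le_one₀ (hq _ _) (hp' _ _) (hp _ _)))

theorem measurableSet_patternEvent {S : Set (ℕ × ℕ)} {z : ℕ}
    (h : ∀ x, z - 2 ≤ x → x ≤ z → ∀ k, (x, k) ∈ S) (i j : ℕ) :
    MeasurableSet[bits S] (patternEvent i j z) :=
  (measurableSet_pattern fun k _ => h z (by omega) le_rfl k).inter
    ((measurableSet_pattern fun k _ => h (z - 1) (by omega) (by omega) k).inter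
      (measurableSet_pattern fun k _ => h (z - 2) le_rfl (by omega) k))

theorem Admissible.measure_patternEvent (h : Admissible p q) (i j : ℕ) {z : ℕ} (hz : 2 ≤ z) :
    stackMeasure p (patternEvent i j z) = ENNReal.ofReal (patternProb p q i j z) := by
  have hp' : ∀ x n, 0 ≤ p x ^ n := fun x n => pow_nonneg (h.p_pos x).le n
  have hq' : ∀ x n, 0 ≤ q x ^ n := fun x n => pow_nonneg (h.q_nonneg x) n
  rw [patternEvent, measure_inter_bits p (S := {a | a.1 = z}) (T := {a | a.1 < z})
    (by rw [Set.disjoint_left]; intro a h1 h2; simp only [Set.mem_ofPred_eq] at h1 h2; omega)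
    (measurableSet_pattern fun k _ => rfl)
    ((measurableSet_pattern fun k _ => (show z - 1 < z by omega)).inter
      (measurableSet_pattern fun k _ => (show z - 2 < z by omega))),
    measure_inter_bits p (S := {a | a.1 = z - 1}) (T := {a | a.1 = z - 2})
    (by rw [Set.disjoint_left]; intro a h1 h2; simp only [Set.mem_ofPred_eq] at h1 h2; omega)
    (measurableSet_pattern fun k _ => rfl) (measurableSet_pattern fun k _ => rfl),
    h.measure_pattern, h.measure_pattern, h.measure_pattern, patternProb,
    ENNReal.ofReal_mul (mul_nonneg (hq' _ _) (hp' _ _)),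
    ENNReal.ofReal_mul (mul_nonneg (hq' _ _) (hp' _ _))]

theorem measurableSet_cutEvent {S : Set (ℕ × ℕ)} {z : ℕ}
    (h : ∀ x, z - 2 ≤ x → ∀ k, (x, k) ∈ S) (i j : ℕ) :
    MeasurableSet[bits S] (cutEvent i j z) :=
  (measurableSet_eventually_ret (fun x hx k => h x (by omega) k) 0).inter
    (measurableSet_patternEvent (fun x hx _ k => h x hx k) i j)

theorem Admissible.measure_cutEvent (h : Admissible p q) (i j : ℕ) {z : ℕ} (hz : 2 ≤ z) :
    stackMeasure p (cutEvent i j z) = (D p q z)⁻¹ * ENNReal.ofReal (patternProb p q i j z) := by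
  rw [cutEvent, measure_inter_bits p (S := {a | z < a.1}) (T := {a | a.1 ≤ z})
    (by rw [Set.disjoint_left]; intro a h1 h2; simp only [Set.mem_ofPred_eq] at h1 h2; omega)
    (measurableSet_eventually_ret (fun x hx k => hx) 0)
    (measurableSet_patternEvent (fun x _ hx k => hx) i j), h.measure_eventually_ret_zero,
    h.measure_patternEvent i j hz]

/-- Starting from `0` at `z = y + 3`, the patterns drive `ret` through `i` and `j` back to `0`. The
site of interest is `y + 2`; the final `0` separates it from everything below. -/
theorem cutEvent_ret {σ : Stacks} {i j y : ℕ} (hσ : σ ∈ cutEvent i j (y + 3)) :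
    (∀ᶠ n in atTop, ret σ (y + 2) n = i) ∧ (∀ᶠ n in atTop, ret σ (y + 1) n = j) ∧
      ∀ᶠ n in atTop, ret σ y n = 0 := by
  obtain ⟨h0, h1, h2, h3⟩ := hσ
  have e1 := eventually_ret_of_pattern (y := y + 2) h0 h1
  have e2 := eventually_ret_of_pattern (y := y + 1) e1 h2
  exact ⟨e1, e2, eventually_ret_of_pattern (y := y) e2 h3⟩

/-- The cut at `z` forbids a return across the edge below `z - 2`, so the absence of returns to `x`
is decided by the stacks strictly between `x` and `z - 2`. The bound is a product over three
independent groups of stacks. -/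
theorem Admissible.measure_cutEvent_inter (h : Admissible p q) (i j : ℕ) {x z : ℕ} (hx : 2 ≤ x)
    (hxz : x + 3 ≤ z) :
    stackMeasure p (cutEvent i j x ∩ cutEvent i j z) ≤
      ENNReal.ofReal (patternProb p q i j x) * ENNReal.ofReal (1 / Dfin p q x (z - 2)) *
        stackMeasure p (cutEvent i j z) := by
  obtain ⟨d, rfl⟩ := Nat.exists_eq_add_of_le hxz
  have hsub : cutEvent i j x ∩ cutEvent i j (x + 3 + d) ⊆
      (patternEvent i j x ∩ {σ | ret σ x d = 0}) ∩ cutEvent i j (x + 3 + d) := by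
    rintro σ ⟨⟨hσ1, hσ2⟩, hσ3⟩
    refine ⟨⟨hσ2, ?_⟩, hσ3⟩
    rw [show x + 3 + d = x + d + 3 by omega] at hσ3
    have h1 := (cutEvent_ret hσ3).2.2
    obtain ⟨N, hN⟩ := eventually_atTop.1 h1
    obtain ⟨M, hM⟩ := eventually_atTop.1 hσ1
    have h2 := ret_add σ x d (N + M) (hN _ (by omega))
    rw [hM _ (by omega)] at h2
    exact h2.symm
  refine (measure_mono hsub).trans (le_of_eq ?_)
  rw [measure_inter_bits p (S := {a | a.1 ≤ x + d}) (T := {a | x + d < a.1})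
    (by rw [Set.disjoint_left]; intro a h1 h2; simp only [Set.mem_ofPred_eq] at h1 h2; omega)
    ((measurableSet_patternEvent
      (fun y _ hy k => (show y ≤ x + d by omega)) i j).inter
      (measurableSet_ret (fun y _ hy k => hy) 0))
    (measurableSet_cutEvent (fun y hy k => (show x + d < y by omega)) i j),
    measure_inter_bits p (S := {a | a.1 ≤ x}) (T := {a | x < a.1})
    (by rw [Set.disjoint_left]; intro a h1 h2; simp only [Set.mem_ofPred_eq] at h1 h2; omega)
    (measurableSet_patternEvent (fun y _ hy k => hy) i j)
    (measurableSet_ret (fun y hy _ k => hy) 0),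
    h.measure_patternEvent i j hx, h.measure_ret_zero,
    show x + 3 + d - 2 = x + 1 + d by omega]

end CutEvents

/-! ### Divergent case: conclusion -/

/-- By symmetry the off-diagonal part is twice the sum over `x < z`, and adding `s n` to `S n`
increases the square by at least `2 * s n * S n`. -/
theorem double_sum_le {a : ℕ → ℕ → ℝ} {s S : ℕ → ℝ} {K : ℕ} {B t : ℝ}
    (hsymm : ∀ x z, a x z = a z x) (hS : ∀ n, S n = ∑ z ∈ Finset.Ico K n, s z)
    (ht : 0 ≤ t) (hdiag : ∀ z, K ≤ z → a z z ≤ s z)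
    (hoff : ∀ z, K ≤ z → ∑ x ∈ Finset.Ico K z, a x z ≤ s z * (B + t * S z)) (n : ℕ) :
    ∑ x ∈ Finset.Ico K n, ∑ z ∈ Finset.Ico K n, a x z ≤ (2 * B + 1) * S n + t * S n ^ 2 := by
  rcases Nat.lt_or_ge n K with hn | hn
  · simp [hS, Finset.Ico_eq_empty_of_le hn.le]
  induction n, hn using Nat.le_induction with
  | base => simp [hS]
  | succ n hn ih =>
    have hSn : S (n + 1) = S n + s n := by rw [hS, hS, Finset.sum_Ico_succ_top hn]
    have hsplit : ∑ x ∈ Finset.Ico K (n + 1), ∑ z ∈ Finset.Ico K (n + 1), a x z =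
        ∑ x ∈ Finset.Ico K n, ∑ z ∈ Finset.Ico K n, a x z +
          2 * ∑ x ∈ Finset.Ico K n, a x n + a n n := by
      simp_rw [Finset.sum_Ico_succ_top hn, Finset.sum_add_distrib]
      have : ∑ z ∈ Finset.Ico K n, a n z = ∑ x ∈ Finset.Ico K n, a x n :=
        Finset.sum_congr rfl fun x _ => hsymm n x
      rw [this]; ring
    rw [hsplit, hSn]
    have h1 := hoff n hn
    have h2 := hdiag n hn
    nlinarith [mul_nonneg ht (sq_nonneg (s n))]

section Divergent

variable {p q : ℕ → ℝ}

theorem Admissible.tendsto_Dfin_toReal (h : Admissible p q) {x : ℕ} (hx : D p q x ≠ ∞) :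
    Tendsto (fun n => Dfin p q x (x + 1 + n)) atTop (𝓝 (D p q x).toReal) := by
  have h1 := tendsto_Dfin p q (fun k => (h.p_pos k).le) h.q_nonneg x
  have h2 : Tendsto (fun n => x + 1 + n) atTop atTop :=
    tendsto_atTop_mono (fun n => show n ≤ x + 1 + n by omega) tendsto_id
  refine ((ENNReal.tendsto_toReal hx).comp (h1.comp h2)).congr fun n => ?_
  simp only [Function.comp_apply]
  exact ENNReal.toReal_ofReal (by linarith [h.one_le_Dfin x n])

theorem Admissible.one_le_D (h : Admissible p q) {x : ℕ} (hx : D p q x ≠ ∞) :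
    1 ≤ (D p q x).toReal :=
  ge_of_tendsto' (h.tendsto_Dfin_toReal hx) fun n => h.one_le_Dfin x n

theorem Admissible.D_succ (h : Admissible p q) {x : ℕ} (hx : D p q x ≠ ∞)
    (hx' : D p q (x + 1) ≠ ∞) :
    (D p q x).toReal = 1 + rho p q (x + 1) * (D p q (x + 1)).toReal := by
  have h1 := (h.tendsto_Dfin_toReal hx).comp (tendsto_add_atTop_nat 1)
  have h2 := ((h.tendsto_Dfin_toReal hx').const_mul (rho p q (x + 1))).const_add 1
  exact tendsto_nhds_unique h1 (h2.congr fun n => (Dfin_succ p q x n).symm)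

/-- The product `ρ₁ ⋯ ρ_x`. -/
def rhoProd (p q : ℕ → ℝ) (x : ℕ) : ℝ := ∏ i ∈ Finset.range x, rho p q (i + 1)

theorem Admissible.rhoProd_pos (h : Admissible p q) (x : ℕ) : 0 < rhoProd p q x :=
  Finset.prod_pos fun i _ => div_pos (h.q_pos _ (by omega)) (h.p_pos _)

theorem rhoProd_mul_Dfin (p q : ℕ → ℝ) (x y : ℕ) :
    rhoProd p q x * Dfin p q x y = ∑ i ∈ Finset.Ico x y, rhoProd p q i := by
  rw [Finset.sum_Ico_eq_sum_range, Dfin, Finset.mul_sum]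
  refine Finset.sum_congr rfl fun j _ => ?_
  rw [rhoProd, rhoProd, Finset.prod_range_add]
  congr 1
  refine Finset.prod_congr rfl fun i _ => ?_
  congr 1; omega

theorem Admissible.ae_infinite_cutEvent (h : Admissible p q)
    (hρ : ∃ K, ∀ k, K < k → rho p q k ≤ 1) (hlim : Tendsto (rho p q) atTop (𝓝 1))
    {n₀ : ℕ} {δ : ℝ} (hδ : 0 < δ)
    (hD : ∀ n : ℕ, n₀ ≤ n → D p q n ≤ ENNReal.ofReal (δ * n * Real.log n))
    (hsum : criterionSum p q = ∞) (i j : ℕ) :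
    ∀ᵐ σ ∂stackMeasure p, {z | σ ∈ cutEvent i j z}.Infinite := by
  obtain ⟨K₀, hK₀⟩ := hρ
  obtain ⟨K₁, hK₁⟩ := eventually_atTop.1 (hlim.eventually_const_le (show (1 / 2 : ℝ) < 1 by norm_num))
  -- The bounds reach down to `K - 2` because the pattern at `z` involves `z - 2`. The lower bound
  -- on `ρ` keeps `q`, and so the pattern probabilities, away from `0`.
  obtain ⟨K, hK3, hKn, hKρ, hKρ'⟩ : ∃ K, 3 ≤ K ∧ n₀ ≤ K ∧ (∀ k, K ≤ k + 2 → rho p q k ≤ 1) ∧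
      ∀ k, K ≤ k + 2 → 1 / 2 ≤ rho p q k :=
    ⟨3 + n₀ + K₀ + K₁, by omega, by omega, fun k hk => hK₀ k (by omega),
      fun k hk => hK₁ k (by omega)⟩
  set P := rhoProd p q with hPdef
  set d : ℕ → ℝ := fun x => (D p q x).toReal with hd
  have hfin : ∀ x, K ≤ x → D p q x ≠ ∞ := fun x hx =>
    ((hD x (by omega)).trans_lt ENNReal.ofReal_lt_top).ne
  have hd1 : ∀ x, K ≤ x → 1 ≤ d x := fun x hx => h.one_le_D (hfin x hx)
  have hP : ∀ x, 0 < P x := h.rhoProd_pos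
  have hPsucc : ∀ x, P (x + 1) = P x * rho p q (x + 1) := fun x => Finset.prod_range_succ _ _
  have hanti : ∀ x y, K ≤ x → x ≤ y → P y ≤ P x := by
    intro x y hx hxy
    induction y, hxy using Nat.le_induction with
    | base => exact le_rfl
    | succ y hy ih =>
      rw [hPsucc]
      exact (mul_le_of_le_one_right (hP y).le (hKρ _ (by omega))).trans ih
  have hR : ∀ x, K ≤ x → 0 < P x * d x := fun x hx =>
    mul_pos (hP x) (by linarith [hd1 x hx])
  have hdiff : ∀ x, K ≤ x → P x * d x - P (x + 1) * d (x + 1) = P x := by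
    intro x hx
    have := h.D_succ (hfin x hx) (hfin (x + 1) (by omega))
    rw [hPsucc, hd]
    simp only
    rw [this]; ring
  have hlog1 : ∀ x : ℕ, K ≤ x → 1 ≤ Real.log x := by
    intro x hx
    rw [Real.le_log_iff_exp_le (by have : 0 < x := by omega
                                   exact_mod_cast this)]
    have : (3 : ℝ) ≤ x := by exact_mod_cast hK3.trans hx
    linarith [Real.exp_one_lt_d9]
  have hDr : ∀ x : ℕ, K ≤ x → P x * d x ≤ δ * x * Real.log x * P x := by
    intro x hx
    have h1 := hlog1 x hx
    have h2 : d x ≤ δ * x * Real.log x :=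
      ENNReal.toReal_le_of_le_ofReal (by positivity) (hD x (by omega))
    rw [mul_comm]
    exact mul_le_mul_of_nonneg_right h2 (hP x).le
  set c := patternProb p q i j with hc
  have hc0 : ∀ x, 0 ≤ c x := h.patternProb_nonneg i j
  have hc1 : ∀ x, c x ≤ 1 := h.patternProb_le_one i j
  have hpK : ∀ x, K ≤ x + 2 → 1 / 2 ≤ p x := fun x hx => h.half_le_p (hKρ x hx)
  have hqK : ∀ x, K ≤ x + 2 → 1 / 4 ≤ q x := by
    intro x hx
    have h1 := hKρ' x hx
    have h2 := hpK x hx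
    unfold rho at h1
    rw [le_div_iff₀ (h.p_pos x)] at h1
    linarith
  obtain ⟨c₀, hc₀, hcK⟩ : ∃ c₀ : ℝ, 0 < c₀ ∧ ∀ x, K ≤ x → c₀ ≤ c x := by
    refine ⟨(1 / 4) ^ i * (1 / 2) ^ 1 * ((1 / 4) ^ j * (1 / 2) ^ (i + 1) *
      ((1 / 4) ^ 0 * (1 / 2) ^ (j + 1))), by positivity, fun x hx => ?_⟩
    have h1 := hpK x (by omega)
    have h2 := hpK (x - 1) (by omega)
    have h3 := hpK (x - 2) (by omega)
    have h4 := hqK x (by omega)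
    have h5 := hqK (x - 1) (by omega)
    have h6 := hqK (x - 2) (by omega)
    have h7 := h.q_nonneg x
    have h8 := h.q_nonneg (x - 1)
    have h9 := h.p_pos x
    have h10 := h.p_pos (x - 1)
    rw [hc]
    unfold patternProb
    gcongr
  set μ := stackMeasure p
  -- The absolute value only makes nonnegativity immediate; it has no effect from `K` on.
  set w : ℕ → ℝ := fun z => |1 / Real.log z| with hw
  have hwK : ∀ z, K ≤ z → w z = 1 / Real.log z := fun z hz =>
    abs_of_nonneg (by have := hlog1 z hz; positivity)
  have hw1 : ∀ z, K ≤ z → w z ≤ 1 := fun z hz => by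
    rw [hwK z hz, div_le_one (by linarith [hlog1 z hz])]; exact hlog1 z hz
  have he : ∀ z, K ≤ z → μ.real (cutEvent i j z) = c z * (P z / (P z * d z)) := by
    intro z hz
    rw [measureReal_def, h.measure_cutEvent i j (by omega), ENNReal.toReal_mul, ENNReal.toReal_inv,
      ENNReal.toReal_ofReal (hc0 z), div_mul_cancel_left₀ (hP z).ne', mul_comm]
  set s : ℕ → ℝ := fun z => w z * μ.real (cutEvent i j z) with hs
  have hsK : ∀ z, K ≤ z → s z = c z / Real.log z * (P z / (P z * d z)) := by
    intro z hz
    rw [hs]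
    simp only
    rw [he z hz, hwK z hz]; ring
  set S : ℕ → ℝ := fun n => ∑ z ∈ Finset.Ico K n, s z with hS
  have hs0 : ∀ z, 0 ≤ s z := fun z => mul_nonneg (abs_nonneg _) measureReal_nonneg
  have hSmono : ∀ m n, m ≤ n → S m ≤ S n := fun m n hmn =>
    Finset.sum_le_sum_of_subset_of_nonneg (Finset.Ico_subset_Ico le_rfl hmn) fun z _ _ => hs0 z
  refine ae_infinite_of_second_moment (S := S) (K := K) (w := w)
    (fun z => (measurableSet_cutEvent (S := Set.univ) (fun _ _ _ => Set.mem_univ _) i j).of_bits)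
    (fun z => abs_nonneg _) (fun n => rfl) ?_ ?_
  · -- the expectations diverge
    have hSlow : ∀ n, ENNReal.ofReal (S n / c₀) + ∑ x ∈ Finset.Ico 2 K,
        (D p q x * ENNReal.ofReal (Real.log x))⁻¹ ≥
        ∑ x ∈ Finset.Ico 2 n, (D p q x * ENNReal.ofReal (Real.log x))⁻¹ := by
      intro n
      have h1 : ∑ x ∈ Finset.Ico K n, (D p q x * ENNReal.ofReal (Real.log x))⁻¹ ≤
          ENNReal.ofReal (S n / c₀) := by
        rw [hS, Finset.sum_div, ENNReal.ofReal_sum_of_nonneg fun z _ => div_nonneg (hs0 z) hc₀.le]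
        refine Finset.sum_le_sum fun x hx => ?_
        have hx := (Finset.mem_Ico.1 hx).1
        have hdx := hd1 x hx
        have hlx := hlog1 x hx
        rw [← ENNReal.ofReal_toReal (hfin x hx), ← ENNReal.ofReal_mul (by positivity),
          ← ENNReal.ofReal_inv_of_pos (by positivity)]
        refine ENNReal.ofReal_le_ofReal ?_
        rw [hsK x hx, div_mul_cancel_left₀ (hP x).ne', le_div_iff₀ hc₀]
        have h2 := hcK x hx
        calc (d x * Real.log x)⁻¹ * c₀ ≤ (d x * Real.log x)⁻¹ * c x := by gcongr
          _ = c x / Real.log x * (d x)⁻¹ := by rw [mul_inv]; ring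
      refine ge_iff_le.2 (le_trans ?_ (add_le_add_left h1 _))
      refine (Finset.sum_le_sum_of_subset (t := Finset.Ico K n ∪ Finset.Ico 2 K) ?_).trans
        (le_self_add.trans_eq Finset.sum_union_inter)
      · intro x hx
        simp only [Finset.mem_union, Finset.mem_Ico] at hx ⊢
        omega
    have hfinK : ∑ x ∈ Finset.Ico 2 K, (D p q x * ENNReal.ofReal (Real.log x))⁻¹ ≠ ∞ := by
      refine ENNReal.sum_ne_top.2 fun x hx => ?_
      have hx := (Finset.mem_Ico.1 hx).1
      rw [Ne, ENNReal.inv_eq_top, mul_eq_zero, not_or]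
      constructor
      · have h1 : ENNReal.ofReal (Dfin p q x (x + 1 + 0)) ≤ D p q x :=
          le_iSup (fun n => ENNReal.ofReal (Dfin p q x n)) _
        have h2 := h.one_le_Dfin x 0
        intro h0
        rw [h0, nonpos_iff_eq_zero, ENNReal.ofReal_eq_zero] at h1
        linarith
      · rw [ENNReal.ofReal_eq_zero, not_le]
        exact Real.log_pos (by exact_mod_cast hx)
    rw [tendsto_atTop]
    intro b
    have ht := ENNReal.tendsto_nat_tsum fun n : ℕ =>
      (D p q (n + 2) * ENNReal.ofReal (Real.log ((n + 2 : ℕ) : ℝ)))⁻¹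
    rw [show ∑' n : ℕ, (D p q (n + 2) * ENNReal.ofReal (Real.log ((n + 2 : ℕ) : ℝ)))⁻¹ = ∞
      from hsum] at ht
    have hlt : ENNReal.ofReal (b / c₀) + ∑ x ∈ Finset.Ico 2 K,
        (D p q x * ENNReal.ofReal (Real.log x))⁻¹ < ∞ :=
      ENNReal.add_lt_top.2 ⟨ENNReal.ofReal_lt_top, lt_top_iff_ne_top.2 hfinK⟩
    obtain ⟨N, hN⟩ := eventually_atTop.1 (ht.eventually (lt_mem_nhds hlt))
    refine eventually_atTop.2 ⟨N + 2, fun n hn => ?_⟩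
    have h1 := hN (n - 2) (by omega)
    have h2 := hSlow n
    rw [Finset.sum_Ico_eq_sum_range _ 2 n] at h2
    simp_rw [add_comm 2] at h2
    have h3 := (ENNReal.add_lt_add_iff_right hfinK).1 (h1.trans_le h2)
    have h4 := (ENNReal.ofReal_lt_ofReal_iff').1 h3
    exact ((div_lt_div_iff_of_pos_right hc₀).1 h4.1).le
  · -- the second moments
    intro ε hε
    -- This `κ` is the one for which `κ / (κ - 1) = 1 + ε`.
    obtain ⟨C, hC0, hC⟩ := sum_div_sub_le (c := c) (κ := (1 + ε) / ε) hK3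
      (by rw [lt_div_iff₀ hε]; linarith) hδ (fun x _ => hP x) hanti hR hdiff hDr hc0 hc1
    have hκ : (1 + ε) / ε / ((1 + ε) / ε - 1) = 1 + ε := by field_simp; ring
    rw [hκ] at hC
    refine ⟨2 * (2 + C) + 1, fun n => ?_⟩
    refine double_sum_le (s := s) (fun x z => by rw [Set.inter_comm]; ring) (fun n => rfl)
      (by linarith) ?_ ?_ n
    · intro z hz
      rw [Set.inter_self, mul_assoc]
      exact mul_le_of_le_one_left (hs0 z) (hw1 z hz)
    · intro z hz
      -- The joint bound needs `x < z - 2`; at most two further values of `x` remain, each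
      -- contributing at most `s z`.
      set m := max K (z - 2) with hm
      have hKm : K ≤ m := le_max_left _ _
      have hmz : m ≤ z := max_le hz (Nat.sub_le _ _)
      have h1 : ∑ x ∈ Finset.Ico K m, w x * w z * μ.real (cutEvent i j x ∩ cutEvent i j z) ≤
          s z * ∑ x ∈ Finset.Ico K m, c x / Real.log x * (P x / (P x * d x - P m * d m)) := by
        rw [Finset.mul_sum]
        refine Finset.sum_le_sum fun x hx => ?_
        obtain ⟨hx, hxm⟩ := Finset.mem_Ico.1 hx
        have hmeq : m = z - 2 := by omega
        have hint := h.measure_cutEvent_inter i j (show 2 ≤ x by omega) (show x + 3 ≤ z by omega)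
        have hreal := ENNReal.toReal_mono (ENNReal.mul_ne_top (ENNReal.mul_ne_top
          ENNReal.ofReal_ne_top ENNReal.ofReal_ne_top) (measure_ne_top _ _)) hint
        have hDpos : 0 < Dfin p q x (z - 2) := by
          have := h.one_le_Dfin x (z - 2 - (x + 1))
          rw [show x + 1 + (z - 2 - (x + 1)) = z - 2 by omega] at this
          linarith
        rw [ENNReal.toReal_mul, ENNReal.toReal_mul, ENNReal.toReal_ofReal (hc0 x),
          ENNReal.toReal_ofReal (by positivity)] at hreal
        have hPD : P x / (P x * d x - P m * d m) = 1 / Dfin p q x (z - 2) := by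
          rw [← sum_Ico_of_sub_eq (R := fun x => P x * d x) hdiff hx hxm.le, hmeq,
            ← rhoProd_mul_Dfin, div_mul_cancel_left₀ (hP x).ne', one_div]
        rw [hPD]
        calc w x * w z * μ.real (cutEvent i j x ∩ cutEvent i j z)
            ≤ w x * w z * (c x * (1 / Dfin p q x (z - 2)) * μ.real (cutEvent i j z)) :=
              mul_le_mul_of_nonneg_left hreal (mul_nonneg (abs_nonneg _) (abs_nonneg _))
          _ = s z * (c x / Real.log x * (1 / Dfin p q x (z - 2))) := by
              rw [hwK x hx, hs]; ring
      have h2 : ∑ x ∈ Finset.Ico m z, w x * w z * μ.real (cutEvent i j x ∩ cutEvent i j z) ≤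
          s z * 2 := by
        calc _ ≤ ∑ x ∈ Finset.Ico m z, s z := by
              refine Finset.sum_le_sum fun x hx => ?_
              have hx := (Finset.mem_Ico.1 hx).1
              have h3 : μ.real (cutEvent i j x ∩ cutEvent i j z) ≤ μ.real (cutEvent i j z) :=
                measureReal_mono Set.inter_subset_right
              rw [mul_assoc]
              refine (mul_le_of_le_one_left (mul_nonneg (abs_nonneg _) measureReal_nonneg)
                (hw1 x (hKm.trans hx))).trans ?_
              exact mul_le_mul_of_nonneg_left h3 (abs_nonneg _)
          _ = s z * ((z - m : ℕ) : ℝ) := by rw [Finset.sum_const, Nat.card_Ico, nsmul_eq_mul, mul_comm]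
          _ ≤ s z * 2 := by
              refine mul_le_mul_of_nonneg_left ?_ (hs0 z)
              have : z - m ≤ 2 := by omega
              exact_mod_cast this
      rw [← Finset.sum_Ico_consecutive _ hKm hmz]
      refine (add_le_add h1 h2).trans ?_
      rw [← mul_add]
      refine mul_le_mul_of_nonneg_left ?_ (hs0 z)
      have h3 := hC m hKm
      have h4 : ∑ x ∈ Finset.Ico K m, c x / Real.log x * (P x / (P x * d x)) = S m :=
        Finset.sum_congr rfl fun x hx => (hsK x (Finset.mem_Ico.1 hx).1).symm
      rw [h4] at h3
      have h5 := mul_le_mul_of_nonneg_left (hSmono m z hmz) (show 0 ≤ 1 + ε by linarith)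
      linarith

theorem Admissible.ae_infinite_walk (h : Admissible p q)
    (hcut : ∀ i j, ∀ᵐ σ ∂stackMeasure p, {z | σ ∈ cutEvent i j z}.Infinite) :
    ∀ᵐ σ ∂stackMeasure p,
      (∀ i j : ℕ, {x | localTime (walk σ) x = ((j + i + 1 : ℕ) : ℕ∞) ∧
        upTime (walk σ) x = ((i + 1 : ℕ) : ℕ∞)}.Infinite) ∧ (Cw (walk σ)).Infinite := by
  have hcut' := ae_all_iff.2 fun i => ae_all_iff.2 (hcut i)
  filter_upwards [h.ae_good, hcut'] with σ hσ hσ'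
  have hdr := driven_walk σ
  have key : ∀ i j : ℕ, {x | localTime (walk σ) x = ((j + i + 1 : ℕ) : ℕ∞) ∧
      upTime (walk σ) x = ((i + 1 : ℕ) : ℕ∞)}.Infinite := by
    intro i j
    rw [Set.infinite_iff_exists_gt]
    intro b
    obtain ⟨z, hz, hz'⟩ := (hσ' i j).exists_gt (b + 3)
    obtain ⟨y, rfl⟩ : ∃ y, z = y + 3 := ⟨z - 3, by omega⟩
    have hr := (cutEvent_ret hz).1
    refine ⟨y + 2, ⟨?_, hdr.upTime_eq hσ hr⟩, by omega⟩
    have hp : Pattern σ (y + 2) j (i + 1) := hz.2.2.1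
    rw [hdr.localTime_eq hσ hr, hp.fails_eq]
  refine ⟨key, (key 0 0).mono fun x hx => ?_⟩
  exact hdr.isWeakCutpoint hσ (by simpa using hx.1) (by simpa using hx.2)

end Divergent

end

end BirthDeath

/-! ### The theorem, transferred from the driven walk. -/

open BirthDeath in
theorem theorem1 {Ω : Type*} [MeasurableSpace Ω] (μ : Measure Ω) [IsProbabilityMeasure μ]
    (p q : ℕ → ℝ) (hp0 : p 0 = 1) (hq0 : q 0 = 0)
    (hp : ∀ k, 1 ≤ k → 0 < p k) (hq : ∀ k, 1 ≤ k → 0 < q k)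
    (hpq : ∀ k, 1 ≤ k → p k + q k = 1)
    (X : ℕ → Ω → ℕ) (hX : BirthDeath.IsWalk μ p q X)
    (hmono : ∃ N₀ : ℕ, 0 < N₀ ∧ MonotoneOn (BirthDeath.rho p q) (Set.Ioi N₀))
    (hlim : Tendsto (BirthDeath.rho p q) atTop (𝓝 1)) :
    (BirthDeath.criterionSum p q < ∞ →
      ∀ᵐ ω ∂μ,
        (∀ a : ℕ, 1 ≤ a → ∀ A : Set ℕ, A ⊆ Set.Ici a →
          (BirthDeath.C (fun k => X k ω) A {a}).Finite) ∧
        (∀ a : ℕ, 1 ≤ a → ∀ B : Set ℕ, B ⊆ Set.Icc 1 a →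
          (BirthDeath.C (fun k => X k ω) {a} B).Finite) ∧
        (BirthDeath.Cw (fun k => X k ω)).Finite) ∧
    ((∃ (n₀ : ℕ) (δ : ℝ), 0 < n₀ ∧ 0 < δ ∧ ∀ n : ℕ, n₀ ≤ n →
        BirthDeath.D p q n ≤ ENNReal.ofReal (δ * n * Real.log n)) →
      BirthDeath.criterionSum p q = ∞ →
      ∀ᵐ ω ∂μ,
        (∀ a : ℕ, 1 ≤ a → ∀ A : Set ℕ, A.Nonempty → A ⊆ Set.Ici a →
          (BirthDeath.C (fun k => X k ω) A {a}).Infinite) ∧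
        (∀ a : ℕ, 1 ≤ a → ∀ B : Set ℕ, B.Nonempty → B ⊆ Set.Icc 1 a →
          (BirthDeath.C (fun k => X k ω) {a} B).Infinite) ∧
        (BirthDeath.Cw (fun k => X k ω)).Infinite) := by
  have h : Admissible p q := by
    refine ⟨fun x => ?_, hq0, hq, fun x => ?_⟩ <;> rcases Nat.eq_zero_or_pos x with rfl | hx
    · rw [hp0]; exact one_pos
    · exact hp x hx
    · rw [hp0, hq0, add_zero]
    · exact hpq x hx
  obtain ⟨N₀, _, hN₀⟩ := hmono
  -- An increasing sequence lies below its limit.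
  have hρ : ∀ k, N₀ < k → rho p q k ≤ 1 := fun k hk =>
    ge_of_tendsto hlim (by
      filter_upwards [eventually_ge_atTop k] with n hn
      exact hN₀ hk (lt_of_lt_of_le hk hn) hn)
  constructor
  · intro hsum
    -- The transfer needs a measurable event, so the uncountably many sets `A` and `B` are replaced
    -- by countably many prescribed values.
    have hmeas : MeasurableSet ({w : ℕ → ℕ | ∀ v : ℕ, {x | upTime w x = ((v + 1 : ℕ) : ℕ∞)}.Finite} ∩
        {w | (Cw w).Finite}) := by
      refine MeasurableSet.inter ?_ (measurableSet_finite measurableSet_isWeakCutpoint)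
      rw [Set.ofPred_forall]
      exact MeasurableSet.iInter fun v => measurableSet_finite fun x => measurableSet_upTime x _
    filter_upwards [hX.ae_of_driven h hmeas (h.ae_finite_walk hρ hsum)] with ω hω
    obtain ⟨h1, h2⟩ := hω
    simp only [Set.mem_ofPred_eq] at h1 h2
    have h1' : ∀ a : ℕ, 1 ≤ a → {x | upTime (fun k => X k ω) x = (a : ℕ∞)}.Finite := by
      intro a ha
      obtain ⟨v, rfl⟩ := Nat.exists_eq_add_of_le' ha
      exact h1 v
    refine ⟨fun a ha A _ => (h1' a ha).subset ?_, fun a ha B hB => ?_, h2⟩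
    · rintro x ⟨_, l, rfl, hl⟩
      exact hl
    · refine ((Set.finite_Icc 1 a).biUnion fun b hb => h1' b hb.1).subset ?_
      rintro x ⟨_, l, hlB, hl⟩
      exact Set.mem_biUnion (hB hlB) hl
  · rintro ⟨n₀, δ, _, hδ, hD⟩ hsum
    have hmeas : MeasurableSet ({w : ℕ → ℕ | ∀ i j : ℕ,
        {x | localTime w x = ((j + i + 1 : ℕ) : ℕ∞) ∧
          upTime w x = ((i + 1 : ℕ) : ℕ∞)}.Infinite} ∩ {w | (Cw w).Infinite}) := by
      refine MeasurableSet.inter ?_ (measurableSet_finite measurableSet_isWeakCutpoint).compl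
      simp_rw [Set.ofPred_forall]
      exact MeasurableSet.iInter fun i => MeasurableSet.iInter fun j =>
        (measurableSet_finite fun x =>
          (measurableSet_localTime x _).inter (measurableSet_upTime x _)).compl
    filter_upwards [hX.ae_of_driven h hmeas (h.ae_infinite_walk fun i j =>
      h.ae_infinite_cutEvent ⟨N₀, hρ⟩ hlim hδ hD hsum i j)] with ω hω
    obtain ⟨h1, h2⟩ := hω
    simp only [Set.mem_ofPred_eq] at h1 h2
    have h1' : ∀ a m : ℕ, 1 ≤ a → a ≤ m → {x | localTime (fun k => X k ω) x = (m : ℕ∞) ∧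
        upTime (fun k => X k ω) x = (a : ℕ∞)}.Infinite := by
      intro a m ha ham
      have := h1 (a - 1) (m - a)
      rwa [show m - a + (a - 1) + 1 = m by omega, show a - 1 + 1 = a by omega] at this
    refine ⟨fun a ha A ⟨m, hm⟩ hA => (h1' a m ha (hA hm)).mono ?_,
      fun a ha B ⟨b, hb⟩ hB => (h1' b a (hB hb).1 (hB hb).2).mono ?_, h2⟩
    · rintro x ⟨hx1, hx2⟩
      exact ⟨⟨m, hm, hx1⟩, a, rfl, hx2⟩
    · rintro x ⟨hx1, hx2⟩
      exact ⟨⟨a, rfl, hx1⟩, b, hb, hx2⟩
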